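/- Setting. Let $\mathcal T$ be a compact subset of a Euclidean space with a finite Borel measure $dt$ (for instance Lebesgue measure), and $\mathcal L_2=\mathcal L_2(\mathcal T,dt)$. Let $\mathcal H$ be a reproducing kernel Hilbert space of square integrable real functions on $\mathcal T$, $\mathcal H_0\subset\mathcal H$ a finite-dimensional subspace, $\mathcal H_1$ its orthogonal complement, and $J(f)=\|f_1\|_{\mathcal H}^2$, where $f_1$ is the component of $f$ in $\mathcal H_1$. Assume that the reproducing kernel $K$ of $\mathcal H_1$ is continuous, and let $\rho_1\ge\rho_2\ge\cdots>0$ and $\psi_1,\psi_2,\ldots$ be the eigenvalues and orthonormal eigenfunctions of its integral operator on $\mathcal L_2$ (which vanishes on the orthogonal complement of the $\psi_k$), with $\rho_k\asymp k^{-2r}$, $r>1/2$. Let $s>1/2$, $M\in\mathbb R$, $A>0$, $M_2>0$, $B>0$, $\alpha_0\in\mathbb R$. We observe $n$ independent copies $(X_i,Y_i)$ of $(X,Y)$, $Y=\alpha_0+\int_{\mathcal T} X\beta_0+\varepsilon$, where $X\sim F$ is a random element of $\mathcal L_2$ with $E\|X\|_{\mathcal L_2}^2<\infty$ and $\varepsilon\sim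 G$ is independent of $X$ with $E\varepsilon=0$ and $\operatorname{Var}\varepsilon\le M_2$. Let $\mathcal F(s,M,K)$ be the class of distributions $F$ whose covariance function $C$ is continuous, with $Cf\ne0$ for all $0\ne f\in\mathcal H_0$, and which satisfy: (a) the eigenvalues $\mu_1\ge\mu_2\ge\cdots$ of $C$ satisfy $A^{-1}k^{-2s}\le\mu_k\le Ak^{-2s}$ for all $k\ge 1$; (b) $E\langle f,X-EX\rangle^4\le M\,(E\langle f,X-EX\rangle^2)^2<\infty$ for all $f\in\mathcal L_2$; (c) if $R$ is the operator on $\mathcal L_2$ of the reproducing kernel of $\mathcal H$ with the norm $\|f\|_R^2=\langle Cf,f\rangle_{\mathcal L_2}+J(f)$, then the $k$th largest eigenvalue of $R^{1/2}CR^{1/2}$ is $\nu_k=(1+\gamma_k^{-1})^{-1}$ with $0<\gamma_k<\infty$ and $A^{-1}\rho_k\mu_k\le\gamma_k\le A\rho_k\mu_k$, for all $k\ge 1$. Let $\mathcal F_\psi$ be the set of those $F\in\mathcal F(s,M,K)$ for which the eigenfunctions of $C$ are $\phi_k=\psi_k$ for all $k\ge1$, and assume that $\mathcal F_\psi$ is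 not empty. Statement. The minimax rate for the squared $\mathcal L_2$ estimation error of the slope over $F\in\mathcal F_\psi$, all such $G$, and $\beta_0\in\mathcal H$ with $J(\beta_0)\le B$, is $n^{-2r/(2(r+s)+1)}$, in the following sense. (1) There is a constant $\delta>0$ such that $$\liminf_{n\to\infty}\ \inf_{\tilde\beta}\ \sup_{F,G,\beta_0}P\Bigl(\|\tilde\beta-\beta_0\|_{\mathcal L_2}^2>\delta\, n^{-\frac{2r}{2(r+s)+1}}\Bigr)>0,$$ where the infimum is over all measurable $\mathcal L_2$-valued functions $\tilde\beta$ of the observations. (2) If $\lambda=\lambda_n>0$ and $\lambda_n\asymp n^{-2(r+s)/(2(r+s)+1)}$, then for all $n$ and all data there is exactly one $\hat\beta_{n\lambda}\in\mathcal H$ which, together with some $\hat\alpha\in\mathbb R$, minimizes $\frac1n\sum_{i=1}^n\bigl[Y_i-\alpha-\int_{\mathcal T} X_i\beta\bigr]^2+\lambda J(\beta)$ over $(\alpha,\beta)\in\mathbb R\times\mathcal H$; it is a measurable function of the data (as an element of $\mathcal L_2$), and it achieves the rate: $$\lim_{D\to\infty}\ \limsup_{n\to\infty}\ \sup_{F,G,\beta_0}P\Bigl(\|\hat\beta_{n\lambda}-\beta_0\|_{\mathcal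 L_2}^2>D\, n^{-\frac{2r}{2(r+s)+1}}\Bigr)=0.$$ -/

import Mathlib

open MeasureTheory ProbabilityTheory Filter Topology
open scoped RealInnerProductSpace ENNReal

namespace FLR

/-- `L2 τ` is the space of (classes of) square integrable real functions on the domain, where `τ`
is the reference measure (the `dt` of all integrals). -/
abbrev L2 {T : Type*} [MeasurableSpace T] (τ : Measure T) : Type _ := Lp ℝ 2 τ

/-- `L2 τ` carries its Borel sigma-algebra. -/
noncomputable instance instMeasurableSpaceL2 {T : Type*} [MeasurableSpace T] (τ : Measure T) :
    MeasurableSpace (L2 τ) := borel _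

instance instBorelSpaceL2 {T : Type*} [MeasurableSpace T] (τ : Measure T) :
    BorelSpace (L2 τ) := ⟨rfl⟩

section Operators

variable {T : Type*} [MeasurableSpace T]

/-- `A` is the integral operator `(A f)(s) = ∫ k(s,t) f(t) dt`. -/
def IsIntegralOperator (τ : Measure T) (k : T → T → ℝ) (A : L2 τ →L[ℝ] L2 τ) : Prop :=
  ∀ f : L2 τ, A f =ᵐ[τ] fun s => ∫ t, k s t * f t ∂τ

/-- Spectral decomposition `A = ∑ₖ eₖ ⟨uₖ, ·⟩ uₖ` with `e₀ ≥ e₁ ≥ ⋯` (each eigenvalue repeated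
according to its multiplicity): the `uₖ` are orthonormal eigenvectors, and `A` vanishes on their
orthogonal complement. The index `k : ℕ` corresponds to `k + 1` in the usual numbering. -/
structure IsEigenSystem {E : Type*} [NormedAddCommGroup E] [InnerProductSpace ℝ E]
    (A : E →L[ℝ] E) (e : ℕ → ℝ) (u : ℕ → E) : Prop where
  orthonormal : Orthonormal ℝ u
  antitone : Antitone e
  apply_eq : ∀ k, A (u k) = e k • u k
  complete : ∀ f, (∀ k, ⟪u k, f⟫ = 0) → A f = 0

/-- The covariance operator `C` of the distribution `F` of a random element `X` of `L2 τ`: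
`⟨C f, g⟩ = Cov(⟨f, X⟩, ⟨g, X⟩)`. -/
noncomputable def covOp {τ : Measure T} (F : Measure (L2 τ)) : L2 τ →L[ℝ] L2 τ :=
  InnerProductSpace.continuousLinearMapOfBilin (covarianceBilin F)

end Operators

section Penalty

variable {T : Type*} {H : Type*} [NormedAddCommGroup H] [InnerProductSpace ℝ H]

/-- The component of `f` in the orthogonal complement `H₁` of `H₀`. -/
noncomputable def pen (H₀ : Submodule ℝ H) [H₀.HasOrthogonalProjection] (f : H) : H :=
  f - H₀.starProjection f

/-- The penalty functional: the squared seminorm `J(f) = ‖f₁‖²` with null space `H₀`. -/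
noncomputable def J (H₀ : Submodule ℝ H) [H₀.HasOrthogonalProjection] (f : H) : ℝ :=
  ‖pen H₀ f‖ ^ 2

/-- The reproducing kernel `K` of `H₁`: `K(·,t)` is the `H₁`-component of the representer in `H`
of the evaluation at `t`. -/
noncomputable def penKernel [CompleteSpace H] [RKHS ℝ H T ℝ]
    (H₀ : Submodule ℝ H) [H₀.HasOrthogonalProjection] (s t : T) : ℝ :=
  pen H₀ (RKHS.kerFun H t (1 : ℝ)) s

/-- The class in `L2 τ` of a function in `H`. -/
noncomputable def toL2 [RKHS ℝ H T ℝ] [MeasurableSpace T] {τ : Measure T}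
    (hH : ∀ f : H, MemLp (f : T → ℝ) 2 τ) (f : H) : L2 τ :=
  (hH f).toLp f

/-- The inner product `⟨f, g⟩_R = ⟨C f, g⟩_{L2} + J(f, g)` of the norm `‖f‖_R² = ⟨C f, f⟩ + J(f)`. -/
noncomputable def innerR [RKHS ℝ H T ℝ] [MeasurableSpace T] {τ : Measure T}
    (hH : ∀ f : H, MemLp (f : T → ℝ) 2 τ) (H₀ : Submodule ℝ H) [H₀.HasOrthogonalProjection]
    (C : L2 τ →L[ℝ] L2 τ) (f g : H) : ℝ :=
  ⟪C (toL2 hH f), toL2 hH g⟫ + ⟪pen H₀ f, pen H₀ g⟫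

/-- `R` is the operator on `L2 τ` attached to the reproducing kernel of `(H, ‖·‖_R)`, that is,
`R f ∈ H` and `⟨R f, g⟩_R = ⟨f, g⟩_{L2}` for all `f ∈ L2` and `g ∈ H`. -/
def IsKernelOperatorR [RKHS ℝ H T ℝ] [MeasurableSpace T] {τ : Measure T}
    (hH : ∀ f : H, MemLp (f : T → ℝ) 2 τ) (H₀ : Submodule ℝ H) [H₀.HasOrthogonalProjection]
    (C R : L2 τ →L[ℝ] L2 τ) : Prop :=
  ∀ f : L2 τ, ∃ h : H, toL2 hH h = R f ∧ ∀ g : H, innerR hH H₀ C h g = ⟪f, toL2 hH g⟫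

end Penalty

section Model

variable {T : Type*} [MeasurableSpace T] {τ : Measure T}
  {H : Type*} [NormedAddCommGroup H] [InnerProductSpace ℝ H] [RKHS ℝ H T ℝ]

/-- The positive numbers `γₖ` obtained from the simultaneous diagonalization of `K` and `C`:
`νₖ = (1 + γₖ⁻¹)⁻¹` is the `k`-th largest eigenvalue of `R^{1/2} C R^{1/2}`. -/
def IsSimDiag (hH : ∀ f : H, MemLp (f : T → ℝ) 2 τ) (H₀ : Submodule ℝ H)
    [H₀.HasOrthogonalProjection] (C : L2 τ →L[ℝ] L2 τ) (γ : ℕ → ℝ) : Prop :=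
  (∀ k, 0 < γ k) ∧
  ∃ R S : L2 τ →L[ℝ] L2 τ, IsKernelOperatorR hH H₀ C R ∧ S.IsPositive ∧ S ∘L S = R ∧
    ∃ ζ : ℕ → L2 τ, IsEigenSystem (S ∘L C ∘L S) (fun k => (1 + (γ k)⁻¹)⁻¹) ζ

/-- The class `𝓕(s, M, K)` of distributions `F` of the process `X`; `ρ` is the sequence of the
eigenvalues of `K`, and `A` is the constant in the relations `≍`. -/
structure ProcessClass [TopologicalSpace T] (hH : ∀ f : H, MemLp (f : T → ℝ) 2 τ)
    (H₀ : Submodule ℝ H) [H₀.HasOrthogonalProjection] (ρ : ℕ → ℝ) (s M A : ℝ)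
    (F : Measure (L2 τ)) : Prop where
  prob : IsProbabilityMeasure F
  memLp : MemLp id 2 F
  /-- the covariance function is continuous -/
  continuous_cov : ∃ c : T → T → ℝ, Continuous (Function.uncurry c) ∧
    IsIntegralOperator τ c (covOp F)
  /-- `C f ≠ 0` for nonzero `f` in the null space of the penalty -/
  nondegenerate : ∀ f ∈ H₀, f ≠ 0 → covOp F (toL2 hH f) ≠ 0
  /-- the fourth moments of linear functionals are finite and controlled by the second moments -/
  fourth_moment : ∀ f : L2 τ, Integrable (fun x => ⟪f, x - ∫ x', x' ∂F⟫ ^ 4) F ∧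
    ∫ x, ⟪f, x - ∫ x', x' ∂F⟫ ^ 4 ∂F ≤ M * (∫ x, ⟪f, x - ∫ x', x' ∂F⟫ ^ 2 ∂F) ^ 2
  /-- `μₖ ≍ k^{-2s}` for the eigenvalues of `C`, and `γₖ ≍ ρₖ μₖ` -/
  decay : ∃ (μ : ℕ → ℝ) (φ : ℕ → L2 τ) (γ : ℕ → ℝ),
    IsEigenSystem (covOp F) μ φ ∧
    (∀ k : ℕ, A⁻¹ * ((k : ℝ) + 1) ^ (-2 * s) ≤ μ k ∧ μ k ≤ A * ((k : ℝ) + 1) ^ (-2 * s)) ∧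
    IsSimDiag hH H₀ (covOp F) γ ∧
    (∀ k : ℕ, A⁻¹ * (ρ k * μ k) ≤ γ k ∧ γ k ≤ A * (ρ k * μ k))

/-- The members of `𝓕(s, M, K)` whose covariance operator has the eigenfunctions `φₖ = ψₖ`. -/
def commonClass [TopologicalSpace T] (hH : ∀ f : H, MemLp (f : T → ℝ) 2 τ)
    (H₀ : Submodule ℝ H) [H₀.HasOrthogonalProjection] (ρ : ℕ → ℝ) (ψ : ℕ → L2 τ) (s M A : ℝ) :
    Set (Measure (L2 τ)) :=
  {F | ProcessClass hH H₀ ρ s M A F ∧ ∃ μ : ℕ → ℝ, IsEigenSystem (covOp F) μ ψ}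

/-- The distributions of a centered noise variable with variance at most `M₂`. -/
def noiseClass (M₂ : ℝ) : Set (Measure ℝ) :=
  {G | IsProbabilityMeasure G ∧ MemLp id 2 G ∧ ∫ e, e ∂G = 0 ∧ ∫ e, e ^ 2 ∂G ≤ M₂}

/-- The joint law of `n` independent copies of `(X, Y)`, where `Y = α₀ + ∫ X β₀ + ε`, `X ∼ F` and
`ε ∼ G` is independent of `X`. -/
noncomputable def dataLaw (n : ℕ) (α₀ : ℝ) (β₀ : L2 τ) (F : Measure (L2 τ)) (G : Measure ℝ) :
    Measure (Fin n → L2 τ × ℝ) :=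
  Measure.pi fun _ => (F.prod G).map fun p => (p.1, α₀ + ⟪p.1, β₀⟫ + p.2)

/-- The regularized least squares criterion
`n⁻¹ ∑ᵢ (yᵢ - (α + ∫ xᵢ β))² + lam J(β)`. -/
noncomputable def criterion (hH : ∀ f : H, MemLp (f : T → ℝ) 2 τ) (H₀ : Submodule ℝ H)
    [H₀.HasOrthogonalProjection] (n : ℕ) (lam : ℝ) (z : Fin n → L2 τ × ℝ) (α : ℝ) (β : H) : ℝ :=
  (1 / (n : ℝ)) * ∑ i, ((z i).2 - (α + ⟪(z i).1, toL2 hH β⟫)) ^ 2 + lam * J H₀ β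

/-- `β` is a regularized estimate of the slope: together with some `α` it minimizes the
criterion over `ℝ × H`. -/
def IsRegularizedSlope (hH : ∀ f : H, MemLp (f : T → ℝ) 2 τ) (H₀ : Submodule ℝ H)
    [H₀.HasOrthogonalProjection] (n : ℕ) (lam : ℝ) (z : Fin n → L2 τ × ℝ) (β : H) : Prop :=
  ∃ α : ℝ, ∀ (α' : ℝ) (β' : H),
    criterion hH H₀ n lam z α β ≤ criterion hH H₀ n lam z α' β'

/-- The worst case probability, over `F ∈ 𝓕`, noise laws in `𝓖` and slopes `β₀ ∈ 𝓑`, that the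
squared `L2` error of the estimator `b` exceeds `u`. -/
noncomputable def worstProb (hH : ∀ f : H, MemLp (f : T → ℝ) 2 τ) (n : ℕ) (α₀ : ℝ)
    (𝓕 : Set (Measure (L2 τ))) (𝓖 : Set (Measure ℝ)) (𝓑 : Set H)
    (b : (Fin n → L2 τ × ℝ) → L2 τ) (u : ℝ) : ℝ≥0∞ :=
  ⨆ F ∈ 𝓕, ⨆ G ∈ 𝓖, ⨆ β₀ ∈ 𝓑,
    dataLaw n α₀ (toL2 hH β₀) F G {z | u < ‖b z - toL2 hH β₀‖ ^ 2}

end Model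

end FLR

/-!
Every `γₖ` is finite, so no eigenvalue of `R^{1/2} C R^{1/2}` equals `1`; a nonzero element of the
null space of the penalty would produce one, hence the null space is trivial and the penalty is the
squared norm of `H`. The integral operator of the kernel is then `ι ι*`, with `ι : H → L²` the
inclusion, so slopes of bounded penalty form the ellipsoid `∑ ⟪ψₖ, β⟫² / ρₖ ≤ B`.

Lower bound: with Gaussian noise, let the slope range over the vertices of a box with edges `cₖ ψₖ`
for `m ≤ k < 2m`. Edges with `cₖ² = B ρₖ / m` keep the box inside the ellipsoid, and neighbouring
vertices cannot be told apart from `n` observations as long as `n cₖ² E⟪ψₖ, X⟫²` stays bounded,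
that is, for `m` of the order of `n^{1 / (2 (r + s) + 1)}`. Assouad's argument over the hypercube
then forces an error proportional to the squared diameter of the box.

Upper bound: centering the data turns the criterion into a ridge regression. In the coordinates of
`x - E x` along `ψₖ`, preceded by the constant feature of the intercept, the population second
moments are diagonal with entries `vₖ`. With probability close to one the empirical Gram matrix is
close to `diag vₖ` in the Hilbert–Schmidt norm weighted by `vₖ + λ / ρₖ`, and the score is of the
order of the effective dimension `∑ vₖ / (vₖ + λ / ρₖ)`, divided by `n`. On that event the basic
inequality of the minimizer bounds the weighted error. Since `vₖ` is of order `k^{-2s}` and `1 / ρₖ`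
of order `k^{2r}`, the weight is at least a multiple of `λ^{s / (r + s)}`, which gives the rate in
`L²`.
-/

namespace FLR

section ProductMeasure

variable {ι : Type*} [Fintype ι] {Z : ι → Type*} [∀ i, MeasurableSpace (Z i)]

theorem lintegral_prod_pi (P : ∀ i, Measure (Z i)) [∀ i, IsProbabilityMeasure (P i)]
    {f : ∀ i, Z i → ℝ≥0∞} (hf : ∀ i, Measurable (f i)) :
    ∫⁻ z, ∏ i, f i (z i) ∂Measure.pi P = ∏ i, ∫⁻ x, f i x ∂P i := by
  rw [lintegral_prod_eq_prod_lintegral_of_indepFun (μ := Measure.pi P) Finset.univ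
    (fun i (z : ∀ i, Z i) => f i (z i)) (iIndepFun_pi fun i => (hf i).aemeasurable)
    fun i => (hf i).comp (measurable_pi_apply i)]
  exact Finset.prod_congr rfl fun i _ => (measurePreserving_eval P i).lintegral_comp (hf i)

theorem pi_withDensity (P : ∀ i, Measure (Z i)) [∀ i, IsProbabilityMeasure (P i)]
    {f : ∀ i, Z i → ℝ≥0∞} (hf : ∀ i, Measurable (f i))
    [∀ i, SigmaFinite ((P i).withDensity (f i))] :
    Measure.pi (fun i => (P i).withDensity (f i))
      = (Measure.pi P).withDensity fun z => ∏ i, f i (z i) := by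
  classical
  refine Measure.pi_eq fun s hs => ?_
  have hind : ∀ z, (Set.univ.pi s).indicator (fun z => ∏ i, f i (z i)) z
      = ∏ i, (s i).indicator (f i) (z i) := fun z => by
    by_cases hz : ∀ i, z i ∈ s i
    · simp only [Set.indicator_of_mem (Set.mem_univ_pi.2 hz), Set.indicator_of_mem (hz _)]
    · rw [Set.indicator_of_notMem (by simpa [Set.mem_univ_pi] using hz)]
      obtain ⟨i, hi⟩ := not_forall.1 hz
      exact (Finset.prod_eq_zero (Finset.mem_univ i) (Set.indicator_of_notMem hi _)).symm
  rw [withDensity_apply _ (MeasurableSet.univ_pi hs),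
    ← lintegral_indicator (MeasurableSet.univ_pi hs), lintegral_congr hind,
    lintegral_prod_pi P fun i => (hf i).indicator (hs i)]
  simp only [lintegral_indicator (hs _), withDensity_apply _ (hs _)]

end ProductMeasure

section HellingerAffinity

variable {Z : Type*} [MeasurableSpace Z]

/- Cauchy–Schwarz for `g = (1_S + g 1_Sᶜ) (g 1_S + 1_Sᶜ)`: the first factor has square integral
`P S + Q Sᶜ`, the second one `Q S + P Sᶜ ≤ 2`. -/
theorem sq_lintegral_le_two_mul_add_compl (P : Measure Z) [IsProbabilityMeasure P]
    {g : Z → ℝ≥0∞} (hg : Measurable g) [IsProbabilityMeasure (P.withDensity fun z => g z ^ 2)]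
    {S : Set Z} (hS : MeasurableSet S) :
    (∫⁻ z, g z ∂P) ^ 2 ≤ 2 * (P S + P.withDensity (fun z => g z ^ 2) Sᶜ) := by
  classical
  set Q := P.withDensity fun z => g z ^ 2 with hQ
  have hsplit : ∀ f h : Z → ℝ≥0∞, ∫⁻ z, S.piecewise f h z ^ 2 ∂P
      = ∫⁻ z in S, f z ^ 2 ∂P + ∫⁻ z in Sᶜ, h z ^ 2 ∂P := fun f h => by
    rw [← lintegral_add_compl _ hS]
    exact congrArg₂ (· + ·)
      (setLIntegral_congr_fun hS fun z hz => by simp only [Set.piecewise_eq_of_mem _ _ _ hz])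
      (setLIntegral_congr_fun hS.compl fun z hz => by
        simp only [Set.piecewise_eq_of_notMem _ _ _ hz])
  have hfirst : ∫⁻ z, S.piecewise (fun _ => 1) g z ^ 2 ∂P = P S + Q Sᶜ := by
    simp [hsplit, hQ, withDensity_apply _ hS.compl]
  have hsecond : ∫⁻ z, S.piecewise g (fun _ => 1) z ^ 2 ∂P ≤ 2 := by
    calc ∫⁻ z, S.piecewise g (fun _ => 1) z ^ 2 ∂P = Q S + P Sᶜ := by
          simp [hsplit, hQ, withDensity_apply _ hS]
      _ ≤ 1 + 1 := add_le_add prob_le_one prob_le_one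
      _ = 2 := one_add_one_eq_two
  have hprod : ∀ z, g z = (S.piecewise (fun _ => 1) g * S.piecewise g (fun _ => 1)) z := fun z => by
    by_cases hz : z ∈ S <;> simp [hz, Set.piecewise]
  have hCS := ENNReal.lintegral_mul_le_Lp_mul_Lq P Real.HolderConjugate.two_two
    (f := S.piecewise (fun _ => 1) g) (g := S.piecewise g fun _ => 1)
    (Measurable.piecewise hS measurable_const hg).aemeasurable
    (Measurable.piecewise hS hg measurable_const).aemeasurable
  simp only [← hprod, ENNReal.rpow_two] at hCS
  calc (∫⁻ z, g z ∂P) ^ 2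
      ≤ ((∫⁻ z, S.piecewise (fun _ => 1) g z ^ 2 ∂P) ^ (1 / 2 : ℝ)
          * (∫⁻ z, S.piecewise g (fun _ => 1) z ^ 2 ∂P) ^ (1 / 2 : ℝ)) ^ 2 := by gcongr
    _ = (∫⁻ z, S.piecewise (fun _ => 1) g z ^ 2 ∂P)
          * ∫⁻ z, S.piecewise g (fun _ => 1) z ^ 2 ∂P := by
        rw [mul_pow, ← ENNReal.rpow_natCast, ← ENNReal.rpow_natCast, ← ENNReal.rpow_mul,
          ← ENNReal.rpow_mul]
        norm_num
    _ ≤ 2 * (P S + Q Sᶜ) := by rw [hfirst, mul_comm]; gcongr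

theorem lintegral_pow_sq_le_two_mul_pi_add_pi_compl {n : ℕ} (P : Measure Z)
    [IsProbabilityMeasure P] {g : Z → ℝ≥0∞} (hg : Measurable g)
    [IsProbabilityMeasure (P.withDensity fun z => g z ^ 2)]
    {S : Set (Fin n → Z)} (hS : MeasurableSet S) :
    ((∫⁻ z, g z ∂P) ^ n) ^ 2 ≤ 2 * ((Measure.pi fun _ : Fin n => P) S
      + (Measure.pi fun _ : Fin n => P.withDensity fun z => g z ^ 2) Sᶜ) := by
  have hpi : Measure.pi (fun _ : Fin n => P.withDensity fun z => g z ^ 2)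
      = (Measure.pi fun _ : Fin n => P).withDensity fun z => (∏ i, g (z i)) ^ 2 := by
    rw [pi_withDensity (fun _ => P) fun _ => hg.pow_const 2]
    simp only [Finset.prod_pow]
  have hprob : IsProbabilityMeasure ((Measure.pi fun _ : Fin n => P).withDensity
      fun z => (∏ i, g (z i)) ^ 2) := hpi ▸ inferInstance
  have haff : ∫⁻ z, ∏ i, g (z i) ∂(Measure.pi fun _ : Fin n => P) = (∫⁻ z, g z ∂P) ^ n := by
    simp [lintegral_prod_pi (fun _ => P) fun _ => hg]
  rw [hpi, ← haff]
  exact sq_lintegral_le_two_mul_add_compl _ (by fun_prop) hS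

end HellingerAffinity

section GaussianRegression

/-- The square root of the likelihood ratio of `gaussianReal m' v` with respect to
`gaussianReal m v`, at `y`. -/
noncomputable def sqrtLikelihoodRatio (v : NNReal) (m m' y : ℝ) : ℝ≥0∞ :=
  ENNReal.ofReal (Real.exp ((y - m) * (m' - m) / (2 * v) - (m' - m) ^ 2 / (4 * v)))

@[fun_prop]
theorem measurable_sqrtLikelihoodRatio {Z : Type*} [MeasurableSpace Z] (v : NNReal)
    {m m' y : Z → ℝ} (hm : Measurable m) (hm' : Measurable m') (hy : Measurable y) :
    Measurable fun z => sqrtLikelihoodRatio v (m z) (m' z) (y z) := by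
  unfold sqrtLikelihoodRatio
  fun_prop

theorem gaussianReal_eq_withDensity_sqrtLikelihoodRatio {v : NNReal} (hv : v ≠ 0) (m m' : ℝ) :
    gaussianReal m' v
      = (gaussianReal m v).withDensity fun y => sqrtLikelihoodRatio v m m' y ^ 2 := by
  have hv' : (v : ℝ) ≠ 0 := mod_cast hv
  rw [gaussianReal_of_var_ne_zero _ hv, gaussianReal_of_var_ne_zero _ hv,
    ← withDensity_mul _ (measurable_gaussianPDF _ _) (by fun_prop)]
  congr 1 with y
  simp only [Pi.mul_apply, gaussianPDF, gaussianPDFReal, sqrtLikelihoodRatio]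
  rw [← ENNReal.ofReal_pow (Real.exp_pos _).le, ← ENNReal.ofReal_mul (by positivity),
    ← Real.exp_nat_mul, mul_assoc (√_)⁻¹, ← Real.exp_add]
  congr 3
  push_cast
  field_simp
  ring

theorem lintegral_sqrtLikelihoodRatio {v : NNReal} (hv : v ≠ 0) (m m' : ℝ) :
    ∫⁻ y, sqrtLikelihoodRatio v m m' y ∂gaussianReal m v
      = ENNReal.ofReal (Real.exp (-((m' - m) ^ 2 / (8 * v)))) := by
  have hv' : (v : ℝ) ≠ 0 := mod_cast hv
  set t := (m' - m) / (2 * v) with ht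
  have hsplit : ∀ y, sqrtLikelihoodRatio v m m' y = ENNReal.ofReal
      (Real.exp (-(m * t) - (m' - m) ^ 2 / (4 * v)) * Real.exp (t * y)) := fun y => by
    rw [sqrtLikelihoodRatio, ← Real.exp_add, ht]
    congr 2
    ring
  have hmgf : ∫ y, Real.exp (t * y) ∂gaussianReal m v = Real.exp (m * t + v * t ^ 2 / 2) :=
    congrFun mgf_id_gaussianReal t
  rw [lintegral_congr hsplit, ← ofReal_integral_eq_lintegral_ofReal
    ((integrable_exp_mul_gaussianReal t).const_mul _) (ae_of_all _ fun y => by positivity),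
    integral_const_mul, hmgf, ← Real.exp_add, ht]
  congr 2
  field_simp
  ring

variable {E : Type*} [MeasurableSpace E]

/-- The joint law of a covariate `x ∼ F` and the response `h x + ε` with independent noise
`ε ∼ G`. -/
noncomputable def regressionLaw (F : Measure E) (G : Measure ℝ) (h : E → ℝ) : Measure (E × ℝ) :=
  (F.prod G).map fun p => (p.1, h p.1 + p.2)

theorem isProbabilityMeasure_regressionLaw (F : Measure E) [IsProbabilityMeasure F]
    (G : Measure ℝ) [IsProbabilityMeasure G] {h : E → ℝ} (hh : Measurable h) :
    IsProbabilityMeasure (regressionLaw F G h) :=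
  Measure.isProbabilityMeasure_map (by fun_prop)

theorem lintegral_regressionLaw_gaussianReal (F : Measure E) {v : NNReal} {h : E → ℝ}
    (hh : Measurable h) {f : E × ℝ → ℝ≥0∞} (hf : Measurable f) :
    ∫⁻ p, f p ∂regressionLaw F (gaussianReal 0 v) h
      = ∫⁻ x, ∫⁻ y, f (x, y) ∂gaussianReal (h x) v ∂F := by
  rw [regressionLaw, lintegral_map hf (by fun_prop), lintegral_prod _ (by fun_prop)]
  refine lintegral_congr fun x => ?_
  have hshift : (gaussianReal 0 v).map (h x + ·) = gaussianReal (h x) v := by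
    rw [gaussianReal_map_const_add, zero_add]
  rw [← hshift, lintegral_map (by fun_prop) (by fun_prop)]

theorem regressionLaw_gaussianReal_eq_withDensity (F : Measure E) {v : NNReal} (hv : v ≠ 0)
    {h h' : E → ℝ} (hh : Measurable h) (hh' : Measurable h') :
    regressionLaw F (gaussianReal 0 v) h' = (regressionLaw F (gaussianReal 0 v) h).withDensity
      fun p => sqrtLikelihoodRatio v (h p.1) (h' p.1) p.2 ^ 2 := by
  ext S hS
  rw [withDensity_apply _ hS, ← lintegral_indicator hS, ← lintegral_indicator_one hS,
    lintegral_regressionLaw_gaussianReal F hh' (measurable_one.indicator hS),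
    lintegral_regressionLaw_gaussianReal F hh (Measurable.indicator (by fun_prop) hS)]
  refine lintegral_congr fun x => ?_
  have hSx : MeasurableSet (Prod.mk x ⁻¹' S) := measurable_prodMk_left hS
  calc ∫⁻ y, S.indicator 1 (x, y) ∂gaussianReal (h' x) v
      = gaussianReal (h' x) v (Prod.mk x ⁻¹' S) := lintegral_indicator_one hSx
    _ = ∫⁻ y in Prod.mk x ⁻¹' S, sqrtLikelihoodRatio v (h x) (h' x) y ^ 2
          ∂gaussianReal (h x) v := by
        rw [gaussianReal_eq_withDensity_sqrtLikelihoodRatio hv (h x), withDensity_apply _ hSx]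
    _ = _ := (lintegral_indicator hSx _).symm

theorem one_sub_le_lintegral_sqrtLikelihoodRatio (F : Measure E) [IsProbabilityMeasure F]
    {v : NNReal} (hv : v ≠ 0) {h h' : E → ℝ} (hh : Measurable h) (hh' : Measurable h')
    (hint : Integrable (fun x => (h' x - h x) ^ 2) F) :
    ENNReal.ofReal (1 - (∫ x, (h' x - h x) ^ 2 ∂F) / (8 * v)) ≤
      ∫⁻ p, sqrtLikelihoodRatio v (h p.1) (h' p.1) p.2 ∂regressionLaw F (gaussianReal 0 v) h := by
  set q : E → ℝ := fun x => (h' x - h x) ^ 2 / (8 * v)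
  have hq0 : ∀ x, 0 ≤ q x := fun x => by positivity
  have hqint : Integrable q F := hint.div_const _
  have hexp : Integrable (fun x => Real.exp (-q x)) F :=
    Integrable.of_bound (by fun_prop) 1 (ae_of_all _ fun x => by
      simpa [abs_of_pos (Real.exp_pos _)] using hq0 x)
  rw [lintegral_regressionLaw_gaussianReal F hh (by fun_prop)]
  simp only [lintegral_sqrtLikelihoodRatio hv]
  calc ENNReal.ofReal (1 - (∫ x, (h' x - h x) ^ 2 ∂F) / (8 * v))
      = ENNReal.ofReal (∫ x, (1 - q x) ∂F) := by
        rw [integral_sub (integrable_const 1) hqint, integral_div]; simp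
    _ ≤ ENNReal.ofReal (∫ x, Real.exp (-q x) ∂F) :=
        ENNReal.ofReal_le_ofReal <| integral_mono ((integrable_const 1).sub hqint) hexp
          fun x => by linarith [Real.add_one_le_exp (-q x)]
    _ = ∫⁻ x, ENNReal.ofReal (Real.exp (-q x)) ∂F :=
        ofReal_integral_eq_lintegral_ofReal hexp (ae_of_all _ fun x => (Real.exp_pos _).le)

theorem one_eighth_le_pi_regressionLaw_add_compl {n : ℕ} (F : Measure E) [IsProbabilityMeasure F]
    {v : NNReal} (hv : v ≠ 0) {h h' : E → ℝ} (hh : Measurable h) (hh' : Measurable h')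
    (hint : Integrable (fun x => (h' x - h x) ^ 2) F)
    (hle : n * ∫ x, (h' x - h x) ^ 2 ∂F ≤ 4 * v)
    {S : Set (Fin n → E × ℝ)} (hS : MeasurableSet S) :
    1 / 8 ≤ (Measure.pi fun _ : Fin n => regressionLaw F (gaussianReal 0 v) h).real S
      + (Measure.pi fun _ : Fin n => regressionLaw F (gaussianReal 0 v) h').real Sᶜ := by
  have hPprob := isProbabilityMeasure_regressionLaw F (gaussianReal 0 v) hh
  have hQprob := isProbabilityMeasure_regressionLaw F (gaussianReal 0 v) hh'
  set w := (∫ x, (h' x - h x) ^ 2 ∂F) / (8 * v)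
  have hw0 : 0 ≤ w := div_nonneg (integral_nonneg fun x => sq_nonneg _) (by positivity)
  have hnw : n * w ≤ 1 / 2 := by
    rw [← mul_div_assoc, div_le_iff₀ (by positivity)]
    linarith
  have haff : ENNReal.ofReal (1 / 2) ≤ (∫⁻ p, sqrtLikelihoodRatio v (h p.1) (h' p.1) p.2
      ∂regressionLaw F (gaussianReal 0 v) h) ^ n := by
    refine le_trans ?_ (pow_le_pow_left'
      (one_sub_le_lintegral_sqrtLikelihoodRatio F hv hh hh' hint) n)
    rcases n.eq_zero_or_pos with rfl | hn
    · simp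
    have hn' : (1 : ℝ) ≤ n := mod_cast hn
    have hw1 : w ≤ 1 / 2 := (le_mul_of_one_le_left hw0 hn').trans hnw
    rw [← ENNReal.ofReal_pow (by linarith)]
    refine ENNReal.ofReal_le_ofReal ?_
    have hbernoulli := one_add_mul_le_pow (a := -w) (by linarith) n
    rw [← sub_eq_add_neg] at hbernoulli
    linarith
  have hdens := regressionLaw_gaussianReal_eq_withDensity F hv hh hh'
  rw [hdens] at hQprob ⊢
  have hmain := (pow_le_pow_left' haff 2).trans
    (lintegral_pow_sq_le_two_mul_pi_add_pi_compl _ (by fun_prop) hS)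
  rw [← ENNReal.ofReal_pow (by norm_num)] at hmain
  have hreal := (ENNReal.ofReal_le_iff_le_toReal (by finiteness)).1 hmain
  rw [ENNReal.toReal_mul, ENNReal.toReal_add (by finiteness) (by finiteness)] at hreal
  simp only [ENNReal.toReal_ofNat] at hreal
  simp only [measureReal_def]
  linarith

end GaussianRegression

section Assouad

variable {ι Z : Type*}

/-- The event that the test with acceptance regions `S` gets the `j`-th bit of `θ` wrong, the
region `S j` being the one where it answers `true`. -/
def bitError (S : ι → Set Z) (θ : ι → Bool) (j : ι) : Set Z :=
  {z | ¬(z ∈ S j ↔ θ j = true)}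

theorem bitError_update_not [DecidableEq ι] (S : ι → Set Z) (θ : ι → Bool) (j : ι) :
    bitError S (Function.update θ j (!θ j)) j = (bitError S θ j)ᶜ := by
  ext z
  cases h : θ j <;> simp [bitError, h]

theorem measurableSet_bitError [MeasurableSpace Z] {S : ι → Set Z}
    (hS : ∀ j, MeasurableSet (S j)) (θ : ι → Bool) (j : ι) :
    MeasurableSet (bitError S θ j) := by
  cases h : θ j
  · simpa [bitError, h] using hS j
  · have hcompl : bitError S θ j = (S j)ᶜ := by ext; simp [bitError, h]
    exact hcompl ▸ (hS j).compl

variable [Fintype ι] [MeasurableSpace Z]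

/- Pairing every vertex `θ` with its neighbour across the `j`-th edge, the average over the cube
of the `j`-th error probability is at least `c / 2`. -/
theorem exists_card_mul_le_sum_bitError [DecidableEq ι] (D : (ι → Bool) → Measure Z)
    (S : ι → Set Z) {c : ℝ}
    (hD : ∀ θ j, c ≤ (D θ).real (bitError S θ j)
      + (D (Function.update θ j (!θ j))).real (bitError S θ j)ᶜ) :
    ∃ θ, Fintype.card ι * (c / 2) ≤ ∑ j, (D θ).real (bitError S θ j) := by
  have hedge : ∀ j, ∑ _θ : ι → Bool, c / 2 ≤ ∑ θ, (D θ).real (bitError S θ j) := fun j => by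
    have hflip : Function.Involutive fun θ : ι → Bool => Function.update θ j (!θ j) :=
      fun θ => by simp
    have hswap := Equiv.sum_comp hflip.toPerm fun θ => (D θ).real (bitError S θ j)
    simp only [Function.Involutive.coe_toPerm, bitError_update_not] at hswap
    have hpair := Finset.sum_le_sum fun θ (_ : θ ∈ Finset.univ) => hD θ j
    rw [Finset.sum_add_distrib, hswap] at hpair
    rw [← Finset.sum_div]
    linarith
  have hsum : ∑ _θ : ι → Bool, Fintype.card ι * (c / 2)
      ≤ ∑ θ, ∑ j, (D θ).real (bitError S θ j) :=
    calc ∑ _θ : ι → Bool, Fintype.card ι * (c / 2) = ∑ _j : ι, ∑ _θ : ι → Bool, c / 2 := by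
          simp only [Finset.sum_const, nsmul_eq_mul, Finset.card_univ]; ring
      _ ≤ ∑ j, ∑ θ, (D θ).real (bitError S θ j) := Finset.sum_le_sum fun j _ => hedge j
      _ = ∑ θ, ∑ j, (D θ).real (bitError S θ j) := Finset.sum_comm
  obtain ⟨θ, -, hθ⟩ := Finset.exists_le_of_sum_le Finset.univ_nonempty hsum
  exact ⟨θ, hθ⟩

theorem sum_measureReal_le_card_mul_add (P : Measure Z) [IsProbabilityMeasure P] {R : ι → Set Z}
    (hR : ∀ j, MeasurableSet (R j)) {W : Set Z} (hW : MeasurableSet W) {a : ℝ} (ha : 0 ≤ a)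
    (hcount : ∀ z ∉ W, ∑ j, (R j).indicator (1 : Z → ℝ) z ≤ a) :
    ∑ j, P.real (R j) ≤ Fintype.card ι * P.real W + a := by
  have hint : ∀ {s : Set Z}, MeasurableSet s → Integrable (s.indicator (1 : Z → ℝ)) P :=
    fun hs => (integrable_const (1 : ℝ)).indicator hs
  have hpoint : ∀ z, ∑ j, (R j).indicator (1 : Z → ℝ) z
      ≤ Fintype.card ι * W.indicator (1 : Z → ℝ) z + a := fun z => by
    by_cases hz : z ∈ W
    · have hcard : ∑ j, (R j).indicator (1 : Z → ℝ) z ≤ ∑ _j : ι, (1 : ℝ) :=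
        Finset.sum_le_sum fun j _ => Set.indicator_le_self' (fun _ _ => zero_le_one) z
      simp only [Finset.sum_const, Finset.card_univ, nsmul_eq_mul, mul_one] at hcard
      simpa [hz] using hcard.trans (le_add_of_nonneg_right ha)
    · simpa [hz] using hcount z hz
  calc ∑ j, P.real (R j) = ∫ z, ∑ j, (R j).indicator (1 : Z → ℝ) z ∂P := by
        rw [integral_finsetSum _ fun j _ => hint (hR j)]
        simp only [integral_indicator_one (hR _)]
    _ ≤ ∫ z, (Fintype.card ι * W.indicator (1 : Z → ℝ) z + a) ∂P :=
        integral_mono (integrable_finsetSum _ fun j _ => hint (hR j))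
          (((hint hW).const_mul _).add (integrable_const a)) hpoint
    _ = Fintype.card ι * P.real W + a := by
        rw [integral_add ((hint hW).const_mul _) (integrable_const a), integral_const_mul,
          integral_indicator_one hW]
        simp

end Assouad

section Hypercube

variable {ι : Type*} [Fintype ι] {E : Type*} [NormedAddCommGroup E] [InnerProductSpace ℝ E]

/-- The vertices of the box spanned by the vectors `c j • u j`, indexed by bit strings. -/
noncomputable def boxVertex (u : ι → E) (c : ι → ℝ) (θ : ι → Bool) : E :=
  ∑ j, (if θ j then c j else 0) • u j

/-- The half space of the points whose `j`-th coordinate is closer to `c j` than to `0`. -/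
def boxHalfSpace (u : ι → E) (c : ι → ℝ) (j : ι) : Set E :=
  {x | c j ^ 2 / 2 ≤ c j * ⟪u j, x⟫}

theorem boxVertex_update_not_sub [DecidableEq ι] (u : ι → E) (c : ι → ℝ) (θ : ι → Bool) (j : ι) :
    boxVertex u c (Function.update θ j (!θ j)) - boxVertex u c θ
      = (if θ j then -c j else c j) • u j := by
  rw [boxVertex, boxVertex, ← Finset.sum_sub_distrib, Finset.sum_eq_single j, ← sub_smul]
  · cases h : θ j <;> simp
  · intro i _ hij
    simp [Function.update_of_ne hij]
  · simp

theorem sq_div_four_le_of_mem_bitError {u : ι → E} (hu : Orthonormal ℝ u) {c : ι → ℝ}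
    {θ : ι → Bool} {x : E} {j : ι} (hx : x ∈ bitError (boxHalfSpace u c) θ j) :
    c j ^ 2 / 4 ≤ ⟪u j, x - boxVertex u c θ⟫ ^ 2 := by
  have hcoord : ⟪u j, x - boxVertex u c θ⟫ = ⟪u j, x⟫ - if θ j then c j else 0 := by
    rw [inner_sub_right, boxVertex, hu.inner_right_fintype]
  rw [hcoord]
  cases h : θ j <;> simp only [bitError, boxHalfSpace, Set.mem_ofPred_eq, h] at hx ⊢
  · have hx' : c j ^ 2 / 2 ≤ c j * ⟪u j, x⟫ := by simpa using hx
    simp only [Bool.false_eq_true, if_false]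
    nlinarith [sq_nonneg (⟪u j, x⟫ - c j / 2)]
  · have hx' : c j * ⟪u j, x⟫ < c j ^ 2 / 2 := by simpa using hx
    simp only [if_true]
    nlinarith [sq_nonneg (⟪u j, x⟫ - c j / 2)]

theorem sum_indicator_bitError_mul_le {u : ι → E} (hu : Orthonormal ℝ u) {c : ι → ℝ} {κ : ℝ}
    (hc : ∀ j, κ ≤ c j ^ 2) (θ : ι → Bool) (x : E) :
    (∑ j, (bitError (boxHalfSpace u c) θ j).indicator (1 : E → ℝ) x) * (κ / 4)
      ≤ ‖x - boxVertex u c θ‖ ^ 2 := by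
  rw [Finset.sum_mul]
  refine (Finset.sum_le_sum fun j _ => ?_).trans
    (hu.sum_inner_products_le (x - boxVertex u c θ) (s := Finset.univ))
  rw [Real.norm_eq_abs, sq_abs]
  by_cases hx : x ∈ bitError (boxHalfSpace u c) θ j
  · rw [Set.indicator_of_mem hx, Pi.one_apply, one_mul]
    linarith [hc j, sq_div_four_le_of_mem_bitError hu hx]
  · rw [Set.indicator_of_notMem hx, zero_mul]
    positivity

variable [MeasurableSpace E] [BorelSpace E] [SecondCountableTopology E]
  {Z : Type*} [MeasurableSpace Z]

theorem exists_boxVertex_le_measureReal_lt_norm_sq [DecidableEq ι] [Nonempty ι]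
    (D : (ι → Bool) → Measure Z) [∀ θ, IsProbabilityMeasure (D θ)]
    (hD : ∀ θ j S, MeasurableSet S →
      1 / 8 ≤ (D θ).real S + (D (Function.update θ j (!θ j))).real Sᶜ)
    {u : ι → E} (hu : Orthonormal ℝ u) {c : ι → ℝ} {κ : ℝ} (hκ : 0 < κ)
    (hc : ∀ j, κ ≤ c j ^ 2) {b : Z → E} (hb : Measurable b) :
    ∃ θ, 1 / 32 ≤
      (D θ).real {z | κ * Fintype.card ι / 128 < ‖b z - boxVertex u c θ‖ ^ 2} := by
  set S : ι → Set Z := fun j => b ⁻¹' boxHalfSpace u c j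
  have hS : ∀ j, MeasurableSet (S j) := fun j =>
    hb (measurableSet_le measurable_const (by fun_prop))
  obtain ⟨θ, hθ⟩ := exists_card_mul_le_sum_bitError D S fun θ j =>
    hD θ j _ (measurableSet_bitError hS θ j)
  refine ⟨θ, ?_⟩
  have hcard : (0 : ℝ) < Fintype.card ι := mod_cast Fintype.card_pos
  have hcount : ∀ z ∉ {z | κ * Fintype.card ι / 128 < ‖b z - boxVertex u c θ‖ ^ 2},
      ∑ j, (bitError S θ j).indicator (1 : Z → ℝ) z ≤ Fintype.card ι / 32 := fun z hz => by
    have hdist := (sum_indicator_bitError_mul_le hu hc θ (b z)).trans (not_lt.1 hz)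
    exact le_of_mul_le_mul_right (hdist.trans_eq (by ring)) (by positivity : 0 < κ / 4)
  have hsum := hθ.trans (sum_measureReal_le_card_mul_add (D θ) (measurableSet_bitError hS θ)
    (measurableSet_lt measurable_const (by fun_prop)) (by positivity) hcount)
  refine le_of_mul_le_mul_left ?_ hcard
  linarith

end Hypercube

section DataLaw

variable {T : Type*} [MeasurableSpace T] {τ : Measure T} [SecondCountableTopology (L2 τ)]

instance isProbabilityMeasure_dataLaw (n : ℕ) (α₀ : ℝ) (β : L2 τ) (F : Measure (L2 τ))
    (G : Measure ℝ) [IsProbabilityMeasure F] [IsProbabilityMeasure G] :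
    IsProbabilityMeasure (dataLaw n α₀ β F G) := by
  have := isProbabilityMeasure_regressionLaw F G (h := fun x => α₀ + ⟪x, β⟫) (by fun_prop)
  exact Measure.pi.instIsProbabilityMeasure fun _ => regressionLaw F G fun x => α₀ + ⟪x, β⟫

theorem dataLaw_apply {n : ℕ} (α₀ : ℝ) (β : L2 τ) (F : Measure (L2 τ)) (G : Measure ℝ)
    [IsProbabilityMeasure F] [IsProbabilityMeasure G] {S : Set (Fin n → L2 τ × ℝ)}
    (hS : MeasurableSet S) :
    dataLaw n α₀ β F G S = (Measure.pi fun _ : Fin n => F.prod G)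
      ((fun z i => ((z i).1, α₀ + ⟪(z i).1, β⟫ + (z i).2)) ⁻¹' S) := by
  have hobs : Measurable fun p : L2 τ × ℝ => (p.1, α₀ + ⟪p.1, β⟫ + p.2) := by fun_prop
  have := Measure.isProbabilityMeasure_map (μ := F.prod G) hobs.aemeasurable
  rw [dataLaw, ← Measure.pi_map_pi fun _ => hobs.aemeasurable, Measure.map_apply (by fun_prop) hS]

theorem one_eighth_le_dataLaw_add_compl {n : ℕ} (α₀ : ℝ) (F : Measure (L2 τ))
    [IsProbabilityMeasure F] (hF : MemLp id 2 F) {v : NNReal} (hv : v ≠ 0) {β β' : L2 τ}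
    (hβ : n * ∫ x, ⟪x, β' - β⟫ ^ 2 ∂F ≤ 4 * v) {S : Set (Fin n → L2 τ × ℝ)}
    (hS : MeasurableSet S) :
    1 / 8 ≤ (dataLaw n α₀ β F (gaussianReal 0 v)).real S
      + (dataLaw n α₀ β' F (gaussianReal 0 v)).real Sᶜ := by
  have hdiff : (fun x : L2 τ => (α₀ + ⟪x, β'⟫ - (α₀ + ⟪x, β⟫)) ^ 2)
      = fun x => ⟪x, β' - β⟫ ^ 2 := by
    funext x
    rw [add_sub_add_left_eq_sub, inner_sub_right]
  exact one_eighth_le_pi_regressionLaw_add_compl F hv (by fun_prop) (by fun_prop)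
    (hdiff ▸ (hF.inner_const (β' - β)).integrable_sq) (by rwa [hdiff]) hS

theorem exists_boxVertex_le_dataLaw {n m : ℕ} (hm : 0 < m) (α₀ : ℝ) (F : Measure (L2 τ))
    [IsProbabilityMeasure F] (hF : MemLp id 2 F) {v : NNReal} (hv : v ≠ 0) {u : Fin m → L2 τ}
    (hu : Orthonormal ℝ u) {c : Fin m → ℝ} {κ : ℝ} (hκ : 0 < κ) (hc : ∀ j, κ ≤ c j ^ 2)
    (hdist : ∀ j, n * (c j ^ 2 * ∫ x, ⟪x, u j⟫ ^ 2 ∂F) ≤ 4 * v)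
    {b : (Fin n → L2 τ × ℝ) → L2 τ} (hb : Measurable b) :
    ∃ θ, 1 / 32 ≤ (dataLaw n α₀ (boxVertex u c θ) F (gaussianReal 0 v)).real
      {z | κ * m / 128 < ‖b z - boxVertex u c θ‖ ^ 2} := by
  have : Nonempty (Fin m) := ⟨⟨0, hm⟩⟩
  have hneighbour : ∀ θ j, n * ∫ x, ⟪x, boxVertex u c (Function.update θ j (!θ j))
      - boxVertex u c θ⟫ ^ 2 ∂F ≤ 4 * v := fun θ j => by
    simp only [boxVertex_update_not_sub, inner_smul_right, mul_pow, integral_const_mul]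
    cases θ j <;> simpa using hdist j
  simpa only [Fintype.card_fin] using exists_boxVertex_le_measureReal_lt_norm_sq
    (fun θ => dataLaw n α₀ (boxVertex u c θ) F (gaussianReal 0 v))
    (fun θ j S hS => one_eighth_le_dataLaw_add_compl α₀ F hF hv (hneighbour θ j) hS) hu hκ hc hb

end DataLaw

section SampleMean

/-- The mean of a finite sample of real numbers; it is `0` if the sample is empty. -/
noncomputable def sampleMean {n : ℕ} (f : Fin n → ℝ) : ℝ := (1 / (n : ℝ)) * ∑ i, f i

variable {n : ℕ} {ι : Type*}

theorem sampleMean_sum (s : Finset ι) (g : ι → Fin n → ℝ) :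
    sampleMean (fun i => ∑ k ∈ s, g k i) = ∑ k ∈ s, sampleMean (g k) := by
  simp only [sampleMean]
  rw [Finset.sum_comm, Finset.mul_sum]

theorem sampleMean_const_mul (c : ℝ) (f : Fin n → ℝ) :
    sampleMean (fun i => c * f i) = c * sampleMean f := by
  simp only [sampleMean, ← Finset.mul_sum]
  ring

theorem tendsto_sampleMean {l : Filter ι} {g : ι → Fin n → ℝ} {f : Fin n → ℝ}
    (h : ∀ i, Tendsto (fun k => g k i) l (𝓝 (f i))) :
    Tendsto (fun k => sampleMean (g k)) l (𝓝 (sampleMean f)) :=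
  (tendsto_finsetSum _ fun i _ => h i).const_mul _

end SampleMean

section Oracle

variable {n : ℕ} {ι : Type*} [DecidableEq ι]

theorem sq_sum_mul_le_sum_mul_sq_mul_sum_sq_div {κ : Type*} {s : Finset κ} {w : κ → ℝ}
    (hw : ∀ k, 0 < w k) (x y : κ → ℝ) :
    (∑ k ∈ s, x k * y k) ^ 2 ≤ (∑ k ∈ s, w k * x k ^ 2) * ∑ k ∈ s, y k ^ 2 / w k :=
  Finset.sum_sq_le_sum_mul_sum_of_sq_le_mul s (fun k _ => mul_nonneg (hw k).le (sq_nonneg _))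
    (fun k _ => div_nonneg (sq_nonneg _) (hw k).le) fun k _ => le_of_eq (by
      have := (hw k).ne'
      field_simp)

/-- The deviation of the empirical second moment of the features `φ j` and `φ k` from its
expectation, when the features are orthogonal with second moments `v`. -/
noncomputable def gramError (φ : ι → Fin n → ℝ) (v : ι → ℝ) (j k : ι) : ℝ :=
  sampleMean (fun i => φ j i * φ k i) - if j = k then v j else 0

/-- The features `φ` and the noise `ε` of a sample are typical: the Gram matrix of the features is
close to the diagonal matrix `v` in the Hilbert–Schmidt norm weighted by `w`, and the squared dual
norm of the score is at most `ζ`. -/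
structure IsRegularSample (φ : ι → Fin n → ℝ) (ε : Fin n → ℝ) (v w : ι → ℝ) (ζ : ℝ) : Prop where
  gram_le : ∀ s : Finset ι,
    ∑ q ∈ s ×ˢ s, gramError φ v q.1 q.2 ^ 2 / (w q.1 * w q.2) ≤ 1 / 16
  score_le : ∀ s : Finset ι, ∑ k ∈ s, sampleMean (fun i => ε i * φ k i) ^ 2 / w k ≤ ζ

theorem sampleMean_sq_sum_sub (φ : ι → Fin n → ℝ) (v d : ι → ℝ) (s : Finset ι) :
    sampleMean (fun i => (∑ k ∈ s, d k * φ k i) ^ 2) - ∑ k ∈ s, v k * d k ^ 2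
      = ∑ q ∈ s ×ˢ s, (d q.1 * d q.2) * gramError φ v q.1 q.2 := by
  have hsq : sampleMean (fun i => (∑ k ∈ s, d k * φ k i) ^ 2)
      = ∑ q ∈ s ×ˢ s, (d q.1 * d q.2) * sampleMean (fun i => φ q.1 i * φ q.2 i) := by
    simp only [sq, Finset.sum_mul_sum, ← Finset.sum_product', sampleMean_sum,
      ← sampleMean_const_mul]
    exact Finset.sum_congr rfl fun q _ => congrArg sampleMean (funext fun i => by ring)
  have hdiag : ∑ k ∈ s, v k * d k ^ 2
      = ∑ q ∈ s ×ˢ s, (d q.1 * d q.2) * if q.1 = q.2 then v q.1 else 0 := by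
    rw [Finset.sum_product]
    refine Finset.sum_congr rfl fun k hk => ?_
    simp only [mul_ite, mul_zero, Finset.sum_ite_eq, hk, if_true]
    ring
  rw [hsq, hdiag, ← Finset.sum_sub_distrib]
  simp only [gramError, mul_sub]

namespace IsRegularSample

variable {φ : ι → Fin n → ℝ} {ε : Fin n → ℝ} {v w : ι → ℝ} {ζ : ℝ}

theorem abs_sampleMean_sq_sub_le (h : IsRegularSample φ ε v w ζ) (hw : ∀ k, 0 < w k)
    (d : ι → ℝ) (s : Finset ι) :
    |sampleMean (fun i => (∑ k ∈ s, d k * φ k i) ^ 2) - ∑ k ∈ s, v k * d k ^ 2|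
      ≤ (∑ k ∈ s, w k * d k ^ 2) / 4 := by
  have hW : 0 ≤ ∑ k ∈ s, w k * d k ^ 2 :=
    Finset.sum_nonneg fun k _ => mul_nonneg (hw k).le (sq_nonneg _)
  have hprod : ∑ q ∈ s ×ˢ s, w q.1 * w q.2 * (d q.1 * d q.2) ^ 2
      = (∑ k ∈ s, w k * d k ^ 2) ^ 2 := by
    rw [sq, Finset.sum_mul_sum, ← Finset.sum_product']
    exact Finset.sum_congr rfl fun q _ => by ring
  refine abs_le_of_sq_le_sq ?_ (by positivity)
  rw [sampleMean_sq_sum_sub]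
  calc (∑ q ∈ s ×ˢ s, (d q.1 * d q.2) * gramError φ v q.1 q.2) ^ 2
      ≤ (∑ q ∈ s ×ˢ s, w q.1 * w q.2 * (d q.1 * d q.2) ^ 2)
          * ∑ q ∈ s ×ˢ s, gramError φ v q.1 q.2 ^ 2 / (w q.1 * w q.2) :=
        sq_sum_mul_le_sum_mul_sq_mul_sum_sq_div (w := fun q : ι × ι => w q.1 * w q.2)
          (fun q => mul_pos (hw q.1) (hw q.2)) _ _
    _ ≤ (∑ k ∈ s, w k * d k ^ 2) ^ 2 * (1 / 16) := by
        rw [hprod]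
        exact mul_le_mul_of_nonneg_left (h.gram_le s) (sq_nonneg _)
    _ = ((∑ k ∈ s, w k * d k ^ 2) / 4) ^ 2 := by ring

theorem sampleMean_mul_sq_le (h : IsRegularSample φ ε v w ζ) (hw : ∀ k, 0 < w k)
    (d : ι → ℝ) (s : Finset ι) :
    sampleMean (fun i => ε i * ∑ k ∈ s, d k * φ k i) ^ 2 ≤ ζ * ∑ k ∈ s, w k * d k ^ 2 := by
  have hlin : sampleMean (fun i => ε i * ∑ k ∈ s, d k * φ k i)
      = ∑ k ∈ s, d k * sampleMean (fun i => ε i * φ k i) := by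
    simp only [Finset.mul_sum, sampleMean_sum, ← sampleMean_const_mul]
    exact Finset.sum_congr rfl fun k _ => congrArg sampleMean (funext fun i => by ring)
  rw [hlin, mul_comm ζ]
  exact (sq_sum_mul_le_sum_mul_sq_mul_sum_sq_div hw _ _).trans
    (mul_le_mul_of_nonneg_left (h.score_le s)
      (Finset.sum_nonneg fun k _ => mul_nonneg (hw k).le (sq_nonneg _)))

variable {a d : ι → ℝ} {f : Fin n → ℝ} {b : ℝ}

/- The basic inequality `hmin` bounds the empirical norm of the prediction error `f` by the noise
term, which Cauchy–Schwarz and the event absorb into the weighted norm of the coefficients. -/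
theorem tsum_mul_sq_le (h : IsRegularSample φ ε v (fun k => v k + a k) ζ) (hv : ∀ k, 0 ≤ v k)
    (ha : ∀ k, 0 ≤ a k) (hw : ∀ k, 0 < v k + a k) (hvd : Summable fun k => v k * d k ^ 2)
    (had : Summable fun k => a k * d k ^ 2) (hf : ∀ i, HasSum (fun k => d k * φ k i) (f i))
    (hmin : sampleMean (fun i => f i ^ 2) + 1 / 2 * ∑' k, a k * d k ^ 2
      ≤ 2 * sampleMean (fun i => ε i * f i) + b) :
    ∑' k, (v k + a k) * d k ^ 2 ≤ 64 * ζ + 8 * b := by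
  have hwd : HasSum (fun k => (v k + a k) * d k ^ 2)
      (∑' k, v k * d k ^ 2 + ∑' k, a k * d k ^ 2) := by
    simpa only [add_mul] using hvd.hasSum.add had.hasSum
  set V := ∑' k, v k * d k ^ 2
  set W := ∑' k, (v k + a k) * d k ^ 2
  have hWsplit : W = V + ∑' k, a k * d k ^ 2 := hwd.tsum_eq
  have hgram : V - W / 4 ≤ sampleMean fun i => f i ^ 2 :=
    le_of_tendsto_of_tendsto'
      (hvd.hasSum.sub (hwd.summable.hasSum.div_const 4))
      (tendsto_sampleMean fun i => (hf i).pow 2) fun s => by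
        rw [Finset.sum_sub_distrib, ← Finset.sum_div]
        linarith [(abs_le.1 (h.abs_sampleMean_sq_sub_le hw d s)).1]
  have hscore : sampleMean (fun i => ε i * f i) ^ 2 ≤ ζ * W :=
    le_of_tendsto_of_tendsto' ((tendsto_sampleMean fun i => (hf i).const_mul (ε i)).pow 2)
      (hwd.summable.hasSum.const_mul ζ) (h.sampleMean_mul_sq_le hw d)
  have hζ : 0 ≤ ζ := by simpa using h.score_le ∅
  have hV : 0 ≤ V := tsum_nonneg fun k => mul_nonneg (hv k) (sq_nonneg _)
  have hA : 0 ≤ ∑' k, a k * d k ^ 2 := tsum_nonneg fun k => mul_nonneg (ha k) (sq_nonneg _)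
  have hcross : 2 * sampleMean (fun i => ε i * f i) ≤ W / 8 + 8 * ζ := by
    refine le_of_sq_le_sq ?_ (by linarith)
    nlinarith [sq_nonneg (W / 8 - 8 * ζ)]
  linarith

end IsRegularSample

end Oracle

section Concentration

theorem lintegral_sq_sampleMean_sub_integral_le {Z : Type*} [MeasurableSpace Z] {n : ℕ}
    (hn : n ≠ 0) (P : Measure Z) [IsProbabilityMeasure P] {h : Z → ℝ} (hh : MemLp h 2 P) :
    ∫⁻ z, ENNReal.ofReal ((sampleMean (fun i => h (z i)) - ∫ x, h x ∂P) ^ 2)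
        ∂(Measure.pi fun _ : Fin n => P)
      ≤ ENNReal.ofReal ((∫ x, h x ^ 2 ∂P) / n) := by
  have hn' : (n : ℝ) ≠ 0 := mod_cast hn
  have hcoord : ∀ i : Fin n, MemLp (fun z : Fin n → Z => h (z i)) 2 (Measure.pi fun _ => P) :=
    fun i => hh.comp_measurePreserving (measurePreserving_eval _ i)
  have hmean : (Measure.pi fun _ : Fin n => P)[fun z => sampleMean fun i => h (z i)]
      = ∫ x, h x ∂P := by
    simp only [sampleMean]
    rw [integral_const_mul, integral_finsetSum _ fun i _ => (hcoord i).integrable one_le_two]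
    have hcoord_mean : ∀ i : Fin n, ∫ z, h (z i) ∂(Measure.pi fun _ : Fin n => P) = ∫ x, h x ∂P :=
      fun i => integral_comp_eval hh.1
    simp only [hcoord_mean, Finset.sum_const, Finset.card_univ, Fintype.card_fin, nsmul_eq_mul]
    field_simp
  have hvar : Var[fun z => sampleMean fun i => h (z i); Measure.pi fun _ : Fin n => P]
      = Var[h; P] / n := by
    have hsum := variance_sum_pi (μ := fun _ : Fin n => P) (X := fun _ => h) fun _ => hh
    rw [Finset.sum_fn] at hsum
    simp only [sampleMean, variance_const_mul, hsum, Finset.sum_const, Finset.card_univ,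
      Fintype.card_fin, nsmul_eq_mul]
    field_simp
  have hL2 : MemLp (fun z => sampleMean fun i => h (z i)) 2 (Measure.pi fun _ : Fin n => P) :=
    (memLp_finsetSum _ fun i _ => hcoord i).const_mul _
  rw [← hmean, ← evariance_eq_lintegral_ofReal, ← hL2.ofReal_variance_eq, hvar]
  gcongr
  exact variance_le_expectation_sq hh.1

theorem measure_not_forall_sum_div_le {Z ι : Type*} [MeasurableSpace Z] [Countable ι]
    (P : Measure Z) {g : ι → Z → ℝ} (hg : ∀ k, Measurable (g k)) {c w : ι → ℝ}
    (hw : ∀ k, 0 < w k) (hc0 : ∀ k, 0 ≤ c k)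
    (hgc : ∀ k, ∫⁻ z, ENNReal.ofReal (g k z ^ 2) ∂P ≤ ENNReal.ofReal (c k))
    (hc : Summable fun k => c k / w k) {ζ : ℝ} (hζ : 0 < ζ) :
    P {z | ¬∀ s : Finset ι, ∑ k ∈ s, g k z ^ 2 / w k ≤ ζ}
      ≤ ENNReal.ofReal ((∑' k, c k / w k) / ζ) := by
  have hint : ∫⁻ z, ∑' k, ENNReal.ofReal (g k z ^ 2 / w k) ∂P
      ≤ ENNReal.ofReal (∑' k, c k / w k) := by
    rw [lintegral_tsum fun k => by fun_prop,
      ENNReal.ofReal_tsum_of_nonneg (fun k => div_nonneg (hc0 k) (hw k).le) hc]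
    refine ENNReal.tsum_le_tsum fun k => ?_
    simp only [ENNReal.ofReal_div_of_pos (hw k), ENNReal.div_eq_inv_mul]
    rw [lintegral_const_mul _ (by fun_prop)]
    gcongr
    exact hgc k
  have hsub : {z | ¬∀ s : Finset ι, ∑ k ∈ s, g k z ^ 2 / w k ≤ ζ}
      ⊆ {z | ENNReal.ofReal ζ ≤ ∑' k, ENNReal.ofReal (g k z ^ 2 / w k)} := fun z hz => by
    obtain ⟨s, hs⟩ := not_forall.1 hz
    calc ENNReal.ofReal ζ ≤ ENNReal.ofReal (∑ k ∈ s, g k z ^ 2 / w k) :=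
          ENNReal.ofReal_le_ofReal (not_le.1 hs).le
      _ = ∑ k ∈ s, ENNReal.ofReal (g k z ^ 2 / w k) :=
          ENNReal.ofReal_sum_of_nonneg fun k _ => div_nonneg (sq_nonneg _) (hw k).le
      _ ≤ ∑' k, ENNReal.ofReal (g k z ^ 2 / w k) := ENNReal.sum_le_tsum s
  calc P {z | ¬∀ s : Finset ι, ∑ k ∈ s, g k z ^ 2 / w k ≤ ζ}
      ≤ (∫⁻ z, ∑' k, ENNReal.ofReal (g k z ^ 2 / w k) ∂P) / ENNReal.ofReal ζ :=
        (measure_mono hsub).trans (meas_ge_le_lintegral_div (by fun_prop)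
          (ENNReal.ofReal_pos.2 hζ).ne' ENNReal.ofReal_ne_top)
    _ ≤ ENNReal.ofReal ((∑' k, c k / w k) / ζ) := by
        rw [ENNReal.ofReal_div_of_pos hζ]
        gcongr

end Concentration

section RandomDesign

variable {ι E : Type*} [DecidableEq ι] [MeasurableSpace E]

/-- The features `φ` of a random element with law `F` are orthogonal in `L²(F)` with second
moments `v`, and their fourth moments are controlled by the second ones. -/
structure IsOrthogonalDesign (F : Measure E) (φ : ι → E → ℝ) (v : ι → ℝ) (M : ℝ) : Prop where
  measurable : ∀ k, Measurable (φ k)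
  memLp : ∀ k, MemLp (φ k) 4 F
  integral_mul : ∀ j k, ∫ x, φ j x * φ k x ∂F = if j = k then v j else 0
  integral_pow_four_le : ∀ k, ∫ x, φ k x ^ 4 ∂F ≤ M * v k ^ 2

namespace IsOrthogonalDesign

variable {F : Measure E} {φ : ι → E → ℝ} {v : ι → ℝ} {M : ℝ}

theorem integral_sq (h : IsOrthogonalDesign F φ v M) (k : ι) : ∫ x, φ k x ^ 2 ∂F = v k := by
  simpa [sq] using h.integral_mul k k

theorem nonneg (h : IsOrthogonalDesign F φ v M) (k : ι) : 0 ≤ v k :=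
  h.integral_sq k ▸ integral_nonneg fun _ => sq_nonneg _

theorem memLp_mul (h : IsOrthogonalDesign F φ v M) (j k : ι) :
    MemLp (fun x => φ j x * φ k x) 2 F := by
  have : ENNReal.HolderTriple 4 4 2 := ⟨by
    rw [show (4 : ℝ≥0∞) = 2 * 2 by norm_num, ENNReal.mul_inv (by simp) (by simp), ← two_mul,
      ← mul_assoc, ENNReal.mul_inv_cancel (by simp) (by simp), one_mul]⟩
  exact (h.memLp k).mul' (h.memLp j)

theorem integral_mul_sq_le (h : IsOrthogonalDesign F φ v M) (hM : 0 ≤ M) (j k : ι) :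
    ∫ x, (φ j x * φ k x) ^ 2 ∂F ≤ M * (v j * v k) := by
  have hpow : ∀ k, (∫ x, (φ k x ^ 2) ^ (2 : ℝ) ∂F) ^ (1 / 2 : ℝ) ≤ √M * v k := fun k => by
    rw [← Real.sqrt_eq_rpow, ← Real.sqrt_sq (h.nonneg k), ← Real.sqrt_mul hM]
    refine Real.sqrt_le_sqrt ((integral_congr_ae (ae_of_all _ fun x => ?_)).trans_le
      (h.integral_pow_four_le k))
    simp only [Real.rpow_two]
    ring
  have hmem : ∀ k, MemLp (fun x => φ k x ^ 2) (ENNReal.ofReal 2) F := fun k => by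
    simpa [sq] using h.memLp_mul k k
  calc ∫ x, (φ j x * φ k x) ^ 2 ∂F = ∫ x, φ j x ^ 2 * φ k x ^ 2 ∂F := by simp only [mul_pow]
    _ ≤ (∫ x, (φ j x ^ 2) ^ (2 : ℝ) ∂F) ^ (1 / 2 : ℝ)
          * (∫ x, (φ k x ^ 2) ^ (2 : ℝ) ∂F) ^ (1 / 2 : ℝ) :=
        integral_mul_le_Lp_mul_Lq_of_nonneg Real.HolderConjugate.two_two
          (ae_of_all _ fun _ => sq_nonneg _) (ae_of_all _ fun _ => sq_nonneg _) (hmem j) (hmem k)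
    _ ≤ √M * v j * (√M * v k) :=
        mul_le_mul (hpow j) (hpow k) (by positivity)
          (mul_nonneg (Real.sqrt_nonneg M) (h.nonneg j))
    _ = M * (v j * v k) := by
        nth_rewrite 3 [← Real.mul_self_sqrt hM]
        ring

end IsOrthogonalDesign

end RandomDesign

section Orthonormal

variable {E κ : Type*} [NormedAddCommGroup E] [InnerProductSpace ℝ E] [CompleteSpace E]
  {u : κ → E}

theorem summable_inner_smul (hu : Orthonormal ℝ u) (f : E) : Summable fun k => ⟪u k, f⟫ • u k := by
  simpa using (hu.orthogonalFamily.summable_iff_norm_sq_summable fun k => ⟪u k, f⟫).2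
    (hu.inner_products_summable (x := f))

theorem inner_sub_tsum_inner_smul (hu : Orthonormal ℝ u) (f : E) (k : κ) :
    ⟪u k, f - ∑' j, ⟪u j, f⟫ • u j⟫ = 0 := by
  have hsum : HasSum (fun j => ⟪u k, ⟪u j, f⟫ • u j⟫) ⟪u k, ∑' j, ⟪u j, f⟫ • u j⟫ :=
    (summable_inner_smul hu f).hasSum.mapL (innerSL ℝ (u k))
  have hsingle := hasSum_single (f := fun j => ⟪u k, ⟪u j, f⟫ • u j⟫) k fun j hj => by
    rw [inner_smul_right, hu.2 hj.symm, mul_zero]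
  rw [inner_sub_right, hsum.unique hsingle, inner_smul_right, real_inner_self_eq_norm_sq, hu.1]
  ring

end Orthonormal

section MinMax

variable {E : Type*} [NormedAddCommGroup E] [InnerProductSpace ℝ E]

theorem exists_ne_zero_forall_inner_sum_smul_eq_zero {ι κ : Type*} [Fintype ι] [Fintype κ]
    (h : Fintype.card κ < Fintype.card ι) (u : ι → E) (w : κ → E) :
    ∃ c : ι → ℝ, c ≠ 0 ∧ ∀ j, ⟪w j, ∑ i, c i • u i⟫ = 0 := by
  let Φ : (ι → ℝ) →ₗ[ℝ] (κ → ℝ) :=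
    LinearMap.pi fun j => (innerₛₗ ℝ (w j)).comp (Fintype.linearCombination ℝ u)
  have hker : LinearMap.ker Φ ≠ ⊥ := LinearMap.ker_ne_bot_of_finrank_lt (by simpa using h)
  obtain ⟨c, hc, hc0⟩ := Submodule.exists_mem_ne_zero_of_ne_bot hker
  refine ⟨c, hc0, fun j => ?_⟩
  simpa [Φ, Fintype.linearCombination_apply] using congrFun (LinearMap.mem_ker.1 hc) j

namespace IsEigenSystem

variable {A : E →L[ℝ] E} {e : ℕ → ℝ} {u : ℕ → E}

theorem mul_norm_sq_le_inner_apply (h : IsEigenSystem A e u) {k : ℕ} (c : Fin (k + 1) → ℝ) :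
    e k * ‖∑ i, c i • u i‖ ^ 2 ≤ ⟪A (∑ i, c i • u i), ∑ i, c i • u i⟫ := by
  have hu : Orthonormal ℝ fun i : Fin (k + 1) => u i := h.orthonormal.comp _ Fin.val_injective
  have hA : A (∑ i, c i • u i) = ∑ i : Fin (k + 1), (c i * e i) • u i := by
    simp only [map_sum, map_smul, h.apply_eq, smul_smul]
  rw [hA, ← real_inner_self_eq_norm_sq, hu.inner_sum, hu.inner_sum, Finset.mul_sum]
  refine Finset.sum_le_sum fun i _ => ?_
  have hei : e k ≤ e i := h.antitone (Nat.lt_succ_iff.1 i.2)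
  simp only [conj_trivial]
  linarith [mul_le_mul_of_nonneg_right hei (mul_self_nonneg (c i))]

variable [CompleteSpace E]

theorem hasSum_apply (h : IsEigenSystem A e u) (f : E) :
    HasSum (fun k => (e k * ⟪u k, f⟫) • u k) (A f) := by
  have hA : A f = A (∑' j, ⟪u j, f⟫ • u j) := sub_eq_zero.1 <| by
    rw [← map_sub]
    exact h.complete _ fun k => inner_sub_tsum_inner_smul h.orthonormal f k
  rw [hA]
  convert (summable_inner_smul h.orthonormal f).hasSum.mapL A using 2 with k
  rw [map_smul, h.apply_eq, smul_smul, mul_comm]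

theorem hasSum_inner_apply (h : IsEigenSystem A e u) (f g : E) :
    HasSum (fun k => e k * ⟪u k, f⟫ * ⟪g, u k⟫) ⟪g, A f⟫ := by
  simpa only [innerSL_apply_apply, inner_smul_right] using (h.hasSum_apply f).mapL (innerSL ℝ g)

theorem inner_eigenvector_apply (h : IsEigenSystem A e u) (k : ℕ) (f : E) :
    ⟪u k, A f⟫ = e k * ⟪u k, f⟫ := by
  refine (h.hasSum_inner_apply f (u k)).unique ?_
  convert hasSum_single (f := fun j => e j * ⟪u j, f⟫ * ⟪u k, u j⟫) k fun j hj => by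
    rw [h.orthonormal.2 hj.symm, mul_zero] using 1
  rw [real_inner_self_eq_norm_sq, h.orthonormal.1]
  ring

theorem eq_zero_of_apply_eq_smul (h : IsEigenSystem A e u) {c : ℝ} (hc : c ≠ 0)
    (he : ∀ k, e k ≠ c) {x : E} (hx : A x = c • x) : x = 0 := by
  have hAx : A x = 0 := h.complete x fun k => by
    have hk := h.inner_eigenvector_apply k x
    rw [hx, inner_smul_right, ← sub_eq_zero, ← sub_mul] at hk
    exact (mul_eq_zero.1 hk).resolve_left (sub_ne_zero.2 (he k).symm)
  exact (smul_eq_zero.1 (hx.symm.trans hAx)).resolve_left hc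

theorem inner_apply_le_mul_norm_sq (h : IsEigenSystem A e u) {k : ℕ} (hk : 0 ≤ e k) {f : E}
    (hf : ∀ j < k, ⟪u j, f⟫ = 0) : ⟪A f, f⟫ ≤ e k * ‖f‖ ^ 2 := by
  rw [real_inner_comm]
  refine le_trans ?_ (mul_le_mul_of_nonneg_left
    (h.orthonormal.tsum_inner_products_le f) hk)
  rw [← tsum_mul_left]
  refine (h.hasSum_inner_apply f f).tsum_eq ▸ (h.hasSum_inner_apply f f).summable.tsum_le_tsum
    (fun j => ?_) ((h.orthonormal.inner_products_summable f).mul_left _)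
  rw [Real.norm_eq_abs, sq_abs, real_inner_comm (u j) f, mul_assoc, ← sq]
  rcases lt_or_ge j k with hj | hj
  · simp [hf j hj]
  · exact mul_le_mul_of_nonneg_right (h.antitone hj) (sq_nonneg _)

-- By a dimension count, some nonzero vector is orthogonal to `u' j` for `j < k` and spanned by
-- `u j` for `j ≤ k`; its Rayleigh quotient separates the two eigenvalues.
theorem eigenvalue_le {e' : ℕ → ℝ} {u' : ℕ → E} (h : IsEigenSystem A e u)
    (h' : IsEigenSystem A e' u') {k : ℕ} (hk : 0 ≤ e' k) : e k ≤ e' k := by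
  obtain ⟨c, hc, horth⟩ := exists_ne_zero_forall_inner_sum_smul_eq_zero (by simp)
    (fun i : Fin (k + 1) => u i) (fun j : Fin k => u' j)
  set f := ∑ i : Fin (k + 1), c i • u i
  have hf : f ≠ 0 := fun hf => hc <| funext <|
    Fintype.linearIndependent_iff.1 (h.orthonormal.comp _ Fin.val_injective).linearIndependent c hf
  have hle : e k * ‖f‖ ^ 2 ≤ e' k * ‖f‖ ^ 2 :=
    (h.mul_norm_sq_le_inner_apply c).trans
      (h'.inner_apply_le_mul_norm_sq hk fun j hj => horth ⟨j, hj⟩)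
  exact le_of_mul_le_mul_right hle (by positivity)

theorem eigenvalue_unique {e' : ℕ → ℝ} {u' : ℕ → E} (h : IsEigenSystem A e u)
    (h' : IsEigenSystem A e' u') (he : ∀ k, 0 ≤ e k) (he' : ∀ k, 0 ≤ e' k) : e = e' :=
  funext fun k => (h.eigenvalue_le h' (he' k)).antisymm (h'.eigenvalue_le h (he k))

end IsEigenSystem

end MinMax

section Factorization

variable {E H : Type*} [NormedAddCommGroup E] [InnerProductSpace ℝ E] [CompleteSpace E]
  [NormedAddCommGroup H] [InnerProductSpace ℝ H] [CompleteSpace H]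
  {ι : H →L[ℝ] E} {ρ : ℕ → ℝ} {ψ : ℕ → E}

namespace IsEigenSystem

theorem adjoint_eq_zero (h : IsEigenSystem (ι ∘L ι.adjoint) ρ ψ) {g : E}
    (hg : ∀ k, ⟪ψ k, g⟫ = 0) : ι.adjoint g = 0 := by
  have hKg : ι (ι.adjoint g) = 0 := h.complete g hg
  rw [← inner_self_eq_zero (𝕜 := ℝ), ContinuousLinearMap.adjoint_inner_left, hKg, inner_zero_right]

theorem hasSum_of_range (h : IsEigenSystem (ι ∘L ι.adjoint) ρ ψ) (x : H) :
    HasSum (fun k => ⟪ψ k, ι x⟫ • ψ k) (ι x) := by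
  have hsum := (summable_inner_smul h.orthonormal (ι x)).hasSum
  set p := ∑' k, ⟪ψ k, ι x⟫ • ψ k
  have hperp : ∀ k, ⟪ψ k, ι x - p⟫ = 0 := inner_sub_tsum_inner_smul h.orthonormal (ι x)
  have hp : ⟪ι x - p, p⟫ = 0 := by
    refine (hsum.mapL (innerSL ℝ (ι x - p))).unique ?_
    simp only [innerSL_apply_apply, inner_smul_right, real_inner_comm (ψ _), hperp, mul_zero]
    exact hasSum_zero
  have hx : ⟪ι x - p, ι x⟫ = 0 := by
    rw [← ContinuousLinearMap.adjoint_inner_left, h.adjoint_eq_zero hperp, inner_zero_left]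
  have hzero : ι x - p = 0 := by
    rw [← inner_self_eq_zero (𝕜 := ℝ), inner_sub_right, hx, hp, sub_zero]
  rwa [← sub_eq_zero.1 hzero] at hsum

theorem hasSum_inner_sq (h : IsEigenSystem (ι ∘L ι.adjoint) ρ ψ) (x : H) :
    HasSum (fun k => ⟪ψ k, ι x⟫ ^ 2) (‖ι x‖ ^ 2) := by
  simpa only [innerSL_apply_apply, inner_smul_right, real_inner_self_eq_norm_sq,
    real_inner_comm (ψ _) (ι x), ← sq] using (h.hasSum_of_range x).mapL (innerSL ℝ (ι x))

theorem orthonormal_adjoint (h : IsEigenSystem (ι ∘L ι.adjoint) ρ ψ) (hρ : ∀ k, 0 < ρ k) :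
    Orthonormal ℝ fun k => (√(ρ k))⁻¹ • ι.adjoint (ψ k) := by
  have hinner : ∀ j k, ⟪ι.adjoint (ψ j), ι.adjoint (ψ k)⟫ = if j = k then ρ k else 0 := by
    intro j k
    have hk : ι (ι.adjoint (ψ k)) = ρ k • ψ k := h.apply_eq k
    rw [ContinuousLinearMap.adjoint_inner_left, hk, inner_smul_right,
      orthonormal_iff_ite.1 h.orthonormal]
    split_ifs <;> simp
  rw [orthonormal_iff_ite]
  intro j k
  rw [inner_smul_left, inner_smul_right, hinner, conj_trivial]
  split_ifs with hjk
  · rw [hjk, ← mul_assoc, ← mul_inv, Real.mul_self_sqrt (hρ k).le, inv_mul_cancel₀ (hρ k).ne']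
  · simp

theorem inner_orthonormal_adjoint_sq (hρ : ∀ k, 0 < ρ k) (x : H) (k : ℕ) :
    ‖⟪(√(ρ k))⁻¹ • ι.adjoint (ψ k), x⟫‖ ^ 2 = ⟪ψ k, ι x⟫ ^ 2 / ρ k := by
  rw [inner_smul_left, ContinuousLinearMap.adjoint_inner_left, Real.norm_eq_abs, sq_abs,
    mul_pow, conj_trivial, inv_pow, Real.sq_sqrt (hρ k).le, inv_mul_eq_div]

theorem summable_inner_sq_div (h : IsEigenSystem (ι ∘L ι.adjoint) ρ ψ) (hρ : ∀ k, 0 < ρ k)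
    (x : H) : Summable fun k => ⟪ψ k, ι x⟫ ^ 2 / ρ k := by
  simpa only [inner_orthonormal_adjoint_sq hρ] using
    (h.orthonormal_adjoint hρ).inner_products_summable (x := x)

theorem tsum_inner_sq_div_le (h : IsEigenSystem (ι ∘L ι.adjoint) ρ ψ) (hρ : ∀ k, 0 < ρ k)
    (x : H) : ∑' k, ⟪ψ k, ι x⟫ ^ 2 / ρ k ≤ ‖x‖ ^ 2 := by
  simpa only [inner_orthonormal_adjoint_sq hρ] using
    (h.orthonormal_adjoint hρ).tsum_inner_products_le (x := x)

theorem exists_apply_eq_sum_smul (h : IsEigenSystem (ι ∘L ι.adjoint) ρ ψ) (hρ : ∀ k, 0 < ρ k)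
    {κ : Type*} [Fintype κ] {σ : κ → ℕ} (hσ : Function.Injective σ) (c : κ → ℝ) :
    ∃ x : H, ι x = ∑ j, c j • ψ (σ j) ∧ ‖x‖ ^ 2 = ∑ j, c j ^ 2 / ρ (σ j) := by
  have hu := (h.orthonormal_adjoint hρ).comp σ hσ
  have hsqrt : ∀ k, √(ρ k) ≠ 0 := fun k => (Real.sqrt_pos.2 (hρ k)).ne'
  refine ⟨∑ j, (c j / √(ρ (σ j))) • (√(ρ (σ j)))⁻¹ • ι.adjoint (ψ (σ j)), ?_, ?_⟩
  · rw [map_sum]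
    refine Finset.sum_congr rfl fun j _ => ?_
    have hj : ι (ι.adjoint (ψ (σ j))) = ρ (σ j) • ψ (σ j) := h.apply_eq _
    rw [map_smul, map_smul, hj, smul_smul, smul_smul]
    nth_rewrite 3 [← Real.mul_self_sqrt (hρ (σ j)).le]
    have := hsqrt (σ j)
    field_simp
  · rw [← real_inner_self_eq_norm_sq]
    refine (hu.inner_sum _ _ Finset.univ).trans (Finset.sum_congr rfl fun j _ => ?_)
    rw [conj_trivial, ← sq, div_pow, Real.sq_sqrt (hρ _).le]

end IsEigenSystem

end Factorization

section Embedding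

variable {T : Type*} [MeasurableSpace T] {τ : Measure T}
  {H : Type*} [NormedAddCommGroup H] [InnerProductSpace ℝ H] [RKHS ℝ H T ℝ]

/-- The inclusion of a space of square integrable functions into `L2 τ`, as a linear map. -/
noncomputable def toL2ₗ (hH : ∀ f : H, MemLp (f : T → ℝ) 2 τ) : H →ₗ[ℝ] L2 τ where
  toFun := toL2 hH
  map_add' f g := (MemLp.toLp_congr _ _ (by simp)).trans (MemLp.toLp_add (hH f) (hH g))
  map_smul' a f := (MemLp.toLp_congr _ _ (by simp)).trans (MemLp.toLp_const_smul a (hH f))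

variable [CompleteSpace H]

/-- The inclusion of a reproducing kernel Hilbert space of square integrable functions into `L2 τ`,
as a bounded operator. Its boundedness follows from the closed graph theorem, because convergence
in `H` implies pointwise convergence. -/
noncomputable def embedding (hH : ∀ f : H, MemLp (f : T → ℝ) 2 τ) : H →L[ℝ] L2 τ :=
  ContinuousLinearMap.ofSeqClosedGraph (g := toL2ₗ hH) fun u x y hu hy => by
    obtain ⟨ns, hns, hae⟩ := (tendstoInMeasure_of_tendsto_Lp hy).exists_seq_tendsto_ae
    have hcoe : ∀ᵐ t ∂τ, ∀ n, toL2 hH (u n) t = u n t := ae_all_iff.2 fun n => (hH (u n)).coeFn_toLp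
    refine Lp.ext ?_
    filter_upwards [hae, hcoe, (hH x).coeFn_toLp] with t ht hut hxt
    refine tendsto_nhds_unique ht ?_
    change Tendsto (fun i => toL2 hH (u (ns i)) t) atTop (𝓝 (toL2 hH x t))
    simp only [hut]
    rw [toL2, hxt]
    exact ((RKHS.continuous_eval t).tendsto x).comp (hu.comp hns.tendsto_atTop)

theorem embedding_apply (hH : ∀ f : H, MemLp (f : T → ℝ) 2 τ) (f : H) :
    embedding hH f = toL2 hH f := rfl

theorem eq_embedding_comp_adjoint (hH : ∀ f : H, MemLp (f : T → ℝ) 2 τ) {Kop : L2 τ →L[ℝ] L2 τ}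
    (hKop : IsIntegralOperator τ (fun s t => RKHS.kerFun H t (1 : ℝ) s) Kop) :
    Kop = embedding hH ∘L (embedding hH).adjoint := by
  have heval : ∀ (f : H) (t : T), f t = ⟪RKHS.kerFun H t (1 : ℝ), f⟫ := fun f t => by
    simp [RKHS.kerFun_inner]
  refine ContinuousLinearMap.ext fun f => Lp.ext ((hKop f).trans ?_)
  rw [ContinuousLinearMap.comp_apply, embedding_apply]
  filter_upwards [(hH ((embedding hH).adjoint f)).coeFn_toLp] with s hs
  rw [toL2, hs, heval, ContinuousLinearMap.adjoint_inner_right, L2.inner_def]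
  refine integral_congr_ae ?_
  filter_upwards [(hH (RKHS.kerFun H s (1 : ℝ))).coeFn_toLp] with t ht
  rw [embedding_apply, toL2, ht, heval, heval, real_inner_comm]
  simp [mul_comm]

end Embedding

section Covariance

variable {T : Type*} [MeasurableSpace T] {τ : Measure T} {F : Measure (L2 τ)}

theorem inner_covOp (f g : L2 τ) : ⟪covOp F f, g⟫ = covarianceBilin F f g := by
  rw [covOp, InnerProductSpace.continuousLinearMapOfBilin_apply]

theorem inner_covOp_self_nonneg (f : L2 τ) : 0 ≤ ⟪covOp F f, f⟫ :=
  inner_covOp (F := F) f f ▸ covarianceBilin_self_nonneg f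

theorem covOp_apply_eq_zero {f : L2 τ} (h : ⟪covOp F f, f⟫ = 0) : covOp F f = 0 := by
  rw [inner_covOp] at h
  have hcs := LinearMap.BilinForm.apply_mul_apply_le_of_forall_zero_le
    (covarianceBilin F).toBilinForm (covarianceBilin_self_nonneg (μ := F)) f (covOp F f)
  rw [← inner_self_eq_zero (𝕜 := ℝ), inner_covOp]
  simp only [ContinuousLinearMap.toBilinForm_apply, h, zero_mul,
    covarianceBilin_comm (covOp F f) f] at hcs
  exact mul_self_eq_zero.1 (hcs.antisymm (mul_self_nonneg _))

end Covariance

section NullSpace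

variable {H : Type*} [NormedAddCommGroup H] [InnerProductSpace ℝ H] {H₀ : Submodule ℝ H}
  [H₀.HasOrthogonalProjection]

theorem pen_eq_zero_iff {f : H} : pen H₀ f = 0 ↔ f ∈ H₀ := by
  rw [pen, sub_eq_zero, eq_comm, Submodule.starProjection_eq_self_iff]

theorem pen_eq_self (h : H₀ = ⊥) (f : H) : pen H₀ f = f := by
  simp [pen, h]

theorem J_eq_norm_sq (h : H₀ = ⊥) (f : H) : J H₀ f = ‖f‖ ^ 2 := by
  rw [J, pen_eq_self h]

variable {T : Type*} [MeasurableSpace T] {τ : Measure T} [RKHS ℝ H T ℝ]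
  {hH : ∀ f : H, MemLp (f : T → ℝ) 2 τ} {F : Measure (L2 τ)}

theorem eq_zero_of_innerR_self_eq_zero
    (hnd : ∀ f ∈ H₀, f ≠ 0 → covOp F (toL2 hH f) ≠ 0) {f : H}
    (hf : innerR hH H₀ (covOp F) f f = 0) : f = 0 := by
  have hC := inner_covOp_self_nonneg (F := F) (toL2 hH f)
  have hpen : 0 ≤ ⟪pen H₀ f, pen H₀ f⟫ := real_inner_self_nonneg
  rw [innerR] at hf
  have hmem : f ∈ H₀ := pen_eq_zero_iff.1 <|
    (inner_self_eq_zero (𝕜 := ℝ)).1 (hpen.antisymm' (by linarith))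
  by_contra hf0
  exact hnd f hmem hf0 (covOp_apply_eq_zero (hC.antisymm' (by linarith)))

theorem kernelOperatorR_covOp_toL2 (hnd : ∀ f ∈ H₀, f ≠ 0 → covOp F (toL2 hH f) ≠ 0)
    {R : L2 τ →L[ℝ] L2 τ} (hR : IsKernelOperatorR hH H₀ (covOp F) R) {f : H} (hf : f ∈ H₀) :
    R (covOp F (toL2 hH f)) = toL2 hH f := by
  obtain ⟨h, hh, hin⟩ := hR (covOp F (toL2 hH f))
  have hpenf : pen H₀ f = 0 := pen_eq_zero_iff.2 hf
  have hpen : pen H₀ (h - f) = pen H₀ h := by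
    rw [← sub_zero (pen H₀ h), ← hpenf]
    simp only [pen, map_sub]
    abel
  have hsub : toL2 hH (h - f) = toL2 hH h - toL2 hH f := map_sub (toL2ₗ hH) h f
  have hzero : innerR hH H₀ (covOp F) (h - f) (h - f) = 0 := by
    have hinner := hin (h - f)
    simp only [innerR, hpen, hsub, map_sub, inner_sub_left] at hinner ⊢
    linarith
  rw [← hh, sub_eq_zero.1 (eq_zero_of_innerR_self_eq_zero hnd hzero)]

-- A nonzero element of the null space would yield the eigenvalue `1` of `R^{1/2} C R^{1/2}`.
theorem nullSpace_eq_bot (hnd : ∀ f ∈ H₀, f ≠ 0 → covOp F (toL2 hH f) ≠ 0) {γ : ℕ → ℝ}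
    (hγ : IsSimDiag hH H₀ (covOp F) γ) : H₀ = ⊥ := by
  obtain ⟨hγ_pos, R, S, hR, -, hSR, ζ, hζ⟩ := hγ
  refine (Submodule.eq_bot_iff _).2 fun f hf => ?_
  by_contra hf0
  have hSS : S (S (covOp F (toL2 hH f))) = toL2 hH f := by
    rw [← ContinuousLinearMap.comp_apply, hSR, kernelOperatorR_covOp_toL2 hnd hR hf]
  have hfix : (S ∘L covOp F ∘L S) (S (covOp F (toL2 hH f)))
      = (1 : ℝ) • S (covOp F (toL2 hH f)) := by
    simp only [ContinuousLinearMap.comp_apply, hSS, one_smul]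
  have hzero := hζ.eq_zero_of_apply_eq_smul one_ne_zero (fun k => ne_of_lt <|
    inv_lt_one_of_one_lt₀ (lt_add_of_pos_right 1 (inv_pos.2 (hγ_pos k)))) hfix
  refine hnd f hf hf0 ?_
  rw [← hSS, hzero, map_zero, map_zero]

end NullSpace

section Ridge

variable {n : ℕ} {H : Type*} [NormedAddCommGroup H] [InnerProductSpace ℝ H]

theorem sampleMean_nonneg {f : Fin n → ℝ} (hf : ∀ i, 0 ≤ f i) : 0 ≤ sampleMean f :=
  mul_nonneg (by positivity) (Finset.sum_nonneg fun i _ => hf i)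

theorem sampleMean_sub_sampleMean_sq_le (f : Fin n → ℝ) (α : ℝ) :
    sampleMean (fun i => (f i - sampleMean f) ^ 2) ≤ sampleMean fun i => (f i - α) ^ 2 := by
  rcases eq_or_ne n 0 with rfl | hn
  · simp [sampleMean]
  have hn' : (n : ℝ) ≠ 0 := mod_cast hn
  have hexp : ∀ a, sampleMean (fun i => (f i - a) ^ 2)
      = sampleMean (fun i => f i ^ 2) - sampleMean f ^ 2 + (sampleMean f - a) ^ 2 := by
    intro a
    simp only [sampleMean, sub_sq, Finset.sum_add_distrib, Finset.sum_sub_distrib,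
      ← Finset.sum_mul, ← Finset.mul_sum, Finset.sum_const, Finset.card_univ, Fintype.card_fin,
      nsmul_eq_mul]
    field_simp
    ring
  rw [hexp α, hexp (sampleMean f), sub_self]
  nlinarith [sq_nonneg (sampleMean f - α)]

/-- The operator of the normal equations of the ridge regression with design points `u`. -/
noncomputable def normalOperator (lam : ℝ) (u : Fin n → H) : H →L[ℝ] H :=
  (1 / (n : ℝ)) • ∑ i, InnerProductSpace.rankOne ℝ (u i) (u i) + lam • 1

/-- The criterion minimized by the ridge regression of the responses `y` on the design points `u`,
without intercept. -/
noncomputable def ridgeLoss (lam : ℝ) (u : Fin n → H) (y : Fin n → ℝ) (β : H) : ℝ :=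
  sampleMean (fun i => (y i - ⟪u i, β⟫) ^ 2) + lam * ‖β‖ ^ 2

/-- The ridge regression estimate, as the solution of the normal equations. -/
noncomputable def ridgeEstimate (lam : ℝ) (u : Fin n → H) (y : Fin n → ℝ) : H :=
  Ring.inverse (normalOperator lam u) ((1 / (n : ℝ)) • ∑ i, y i • u i)

theorem inner_normalOperator (lam : ℝ) (u : Fin n → H) (x h : H) :
    ⟪normalOperator lam u x, h⟫ = sampleMean (fun i => ⟪u i, x⟫ * ⟪u i, h⟫) + lam * ⟪x, h⟫ := by
  simp [normalOperator, sampleMean, inner_add_left, inner_smul_left, sum_inner]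

variable [CompleteSpace H] {lam : ℝ}

theorem isUnit_normalOperator (hlam : 0 < lam) (u : Fin n → H) :
    IsUnit (normalOperator lam u) := by
  refine ContinuousLinearMap.isUnit_of_forall_le_norm_inner_map _ (c := ⟨lam, hlam.le⟩) hlam
    fun x => le_trans ?_ (le_abs_self _)
  rw [inner_normalOperator, real_inner_self_eq_norm_sq]
  have hmean := sampleMean_nonneg fun i => mul_self_nonneg ⟪u i, x⟫
  change ‖x‖ ^ 2 * lam ≤ _
  linarith

theorem continuous_ridgeEstimate {Z : Type*} [TopologicalSpace Z] {u : Z → Fin n → H}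
    {y : Z → Fin n → ℝ} (hlam : 0 < lam) (hu : ∀ i, Continuous fun z => u z i)
    (hy : ∀ i, Continuous fun z => y z i) :
    Continuous fun z => ridgeEstimate lam (u z) (y z) := by
  have hnormal : Continuous fun z => normalOperator lam (u z) := by
    have hgram : Continuous fun z => ∑ i, InnerProductSpace.rankOne ℝ (u z i) (u z i) :=
      continuous_finsetSum _ fun i _ =>
        ((InnerProductSpace.rankOne (𝕜 := ℝ) (E := H) (F := H)).continuous.comp
          (hu i)).clm_apply (hu i)
    exact (hgram.const_smul (1 / (n : ℝ))).add continuous_const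
  have hinv : Continuous fun z => Ring.inverse (normalOperator lam (u z)) := by
    refine continuous_iff_continuousAt.2 fun z => ?_
    have h := NormedRing.inverse_continuousAt (isUnit_normalOperator hlam (u z)).unit
    exact ContinuousAt.comp (f := fun z => normalOperator lam (u z)) h hnormal.continuousAt
  exact hinv.clm_apply
    (continuous_const.smul (continuous_finsetSum _ fun i _ => (hy i).smul (hu i)))

theorem normal_equations (hlam : 0 < lam) (u : Fin n → H) (y : Fin n → ℝ) (h : H) :
    sampleMean (fun i => (y i - ⟪u i, ridgeEstimate lam u y⟫) * ⟪u i, h⟫)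
      = lam * ⟪ridgeEstimate lam u y, h⟫ := by
  have hsolve : normalOperator lam u (ridgeEstimate lam u y) = (1 / (n : ℝ)) • ∑ i, y i • u i :=
    congrArg (fun f : H →L[ℝ] H => f _) (Ring.mul_inverse_cancel _ (isUnit_normalOperator hlam u))
  have hinner := congrArg (⟪·, h⟫) hsolve
  simp only [inner_normalOperator, sampleMean, inner_smul_left, sum_inner, conj_trivial] at hinner
  simp only [sampleMean, sub_mul, Finset.sum_sub_distrib, mul_sub]
  linarith

theorem ridgeLoss_eq_add (hlam : 0 < lam) (u : Fin n → H) (y : Fin n → ℝ) (β : H) :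
    ridgeLoss lam u y β = ridgeLoss lam u y (ridgeEstimate lam u y)
      + (sampleMean (fun i => ⟪u i, β - ridgeEstimate lam u y⟫ ^ 2)
          + lam * ‖β - ridgeEstimate lam u y‖ ^ 2) := by
  have hnormal := normal_equations hlam u y (β - ridgeEstimate lam u y)
  set b := ridgeEstimate lam u y
  have hnorm : ‖β‖ ^ 2 = ‖b‖ ^ 2 + 2 * ⟪b, β - b⟫ + ‖β - b‖ ^ 2 := by
    rw [← norm_add_sq_real, add_sub_cancel]
  have hsq : ∀ i, (y i - ⟪u i, β⟫) ^ 2 = (y i - ⟪u i, b⟫) ^ 2 + ⟪u i, β - b⟫ ^ 2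
      - 2 * ((y i - ⟪u i, b⟫) * ⟪u i, β - b⟫) := fun i => by
    rw [inner_sub_right]
    ring
  simp only [sampleMean] at hnormal
  simp only [ridgeLoss, sampleMean, hsq, hnorm, Finset.sum_sub_distrib, Finset.sum_add_distrib,
    ← Finset.mul_sum]
  linear_combination -2 * hnormal

theorem forall_ridgeLoss_le_iff (hlam : 0 < lam) (u : Fin n → H) (y : Fin n → ℝ) (β : H) :
    (∀ β', ridgeLoss lam u y β ≤ ridgeLoss lam u y β') ↔ β = ridgeEstimate lam u y := by
  have hmean : ∀ x : H, 0 ≤ sampleMean fun i => ⟪u i, x⟫ ^ 2 := fun x =>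
    sampleMean_nonneg fun i => sq_nonneg _
  constructor
  · intro hmin
    have hle := hmin (ridgeEstimate lam u y)
    rw [ridgeLoss_eq_add hlam] at hle
    have hdist : lam * ‖β - ridgeEstimate lam u y‖ ^ 2 ≤ 0 := by
      linarith [hmean (β - ridgeEstimate lam u y)]
    by_contra hne
    have : 0 < ‖β - ridgeEstimate lam u y‖ := norm_pos_iff.2 (sub_ne_zero.2 hne)
    exact absurd hdist (not_le.2 (by positivity))
  · rintro rfl β'
    rw [ridgeLoss_eq_add hlam u y β']
    linarith [hmean (β' - ridgeEstimate lam u y),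
      mul_nonneg hlam.le (sq_nonneg ‖β' - ridgeEstimate lam u y‖)]

end Ridge

section RegularizedSlope

variable {n : ℕ} {E H : Type*} [NormedAddCommGroup E] [InnerProductSpace ℝ E] [CompleteSpace E]
  [NormedAddCommGroup H] [InnerProductSpace ℝ H] [CompleteSpace H] {lam : ℝ}

/-- The ridge regression estimate of the slope from data with an intercept: centering the data
eliminates the intercept. -/
noncomputable def slopeEstimate (ι : H →L[ℝ] E) (lam : ℝ) (z : Fin n → E × ℝ) : H :=
  ridgeEstimate lam (fun i => ι.adjoint ((z i).1 - (1 / (n : ℝ)) • ∑ j, (z j).1))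
    fun i => (z i).2 - sampleMean fun j => (z j).2

theorem continuous_slopeEstimate (ι : H →L[ℝ] E) (hlam : 0 < lam) :
    Continuous fun z : Fin n → E × ℝ => slopeEstimate ι lam z := by
  refine continuous_ridgeEstimate hlam (fun i => by fun_prop) fun i => ?_
  unfold sampleMean
  fun_prop

variable {T : Type*} [MeasurableSpace T] {τ : Measure T} [RKHS ℝ H T ℝ]
  {hH : ∀ f : H, MemLp (f : T → ℝ) 2 τ} {H₀ : Submodule ℝ H} [H₀.HasOrthogonalProjection]

theorem isRegularizedSlope_iff (h0 : H₀ = ⊥) (hlam : 0 < lam) (z : Fin n → L2 τ × ℝ) (β : H) :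
    IsRegularizedSlope hH H₀ n lam z β ↔ β = slopeEstimate (embedding hH) lam z := by
  rw [slopeEstimate, ← forall_ridgeLoss_le_iff hlam]
  set u := fun i => (embedding hH).adjoint ((z i).1 - (1 / (n : ℝ)) • ∑ j, (z j).1)
  set y := fun i => (z i).2 - sampleMean fun j => (z j).2
  set res := fun (β : H) i => (z i).2 - ⟪(z i).1, toL2 hH β⟫
  have hcrit : ∀ α β, criterion hH H₀ n lam z α β
      = sampleMean (fun i => (res β i - α) ^ 2) + lam * ‖β‖ ^ 2 := fun α β => by
    simp only [criterion, sampleMean, J_eq_norm_sq h0, res, sub_sub, add_comm α]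
  have hloss : ∀ β, ridgeLoss lam u y β = criterion hH H₀ n lam z (sampleMean (res β)) β := by
    intro β
    rw [hcrit, ridgeLoss]
    refine congrArg (fun f => sampleMean f + _) (funext fun i => congrArg (· ^ 2) ?_)
    simp only [u, y, res, sampleMean, ContinuousLinearMap.adjoint_inner_left, embedding_apply,
      inner_sub_left, inner_smul_left, sum_inner, conj_trivial, Finset.sum_sub_distrib]
    ring
  have hcenter : ∀ α β, ridgeLoss lam u y β ≤ criterion hH H₀ n lam z α β := fun α β => by
    rw [hloss, hcrit, hcrit]
    gcongr
    exact sampleMean_sub_sampleMean_sq_le _ _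
  constructor
  · rintro ⟨α, hα⟩ β'
    exact (hcenter α β).trans ((hα _ β').trans_eq (hloss β').symm)
  · intro hmin
    exact ⟨_, fun α' β' => (hloss β).symm.trans_le ((hmin β').trans (hcenter α' β'))⟩

end RegularizedSlope

section RegularSample

variable {ι E : Type*} [MeasurableSpace E]

theorem integral_noise_mul {M₂ : ℝ} {G : Measure ℝ} (hG : G ∈ noiseClass M₂) (F : Measure E)
    [SFinite F] (f : E → ℝ) : ∫ p, p.2 * f p.1 ∂(F.prod G) = 0 := by
  have := hG.1
  simp only [mul_comm _ (f _)]
  rw [integral_prod_mul f fun e => e, hG.2.2.1, mul_zero]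

namespace IsOrthogonalDesign

variable [DecidableEq ι] {F : Measure E} [IsProbabilityMeasure F] {G : Measure ℝ}
  {φ : ι → E → ℝ} {v w : ι → ℝ} {M M₂ ζ : ℝ} {n : ℕ}

theorem memLp_noise_mul (h : IsOrthogonalDesign F φ v M) (hG : G ∈ noiseClass M₂) (k : ι) :
    MemLp (fun p : E × ℝ => p.2 * φ k p.1) 2 (F.prod G) := by
  have := hG.1
  have hφ : Integrable (fun x => φ k x ^ 2) F := by
    simpa only [sq] using (h.memLp_mul k k).integrable one_le_two
  have hmeas := h.measurable k
  refine (memLp_two_iff_integrable_sq (by fun_prop)).2 ?_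
  simpa only [mul_pow, mul_comm, id_eq] using hφ.mul_prod hG.2.1.integrable_sq

theorem integral_noise_mul_sq_le (h : IsOrthogonalDesign F φ v M) (hG : G ∈ noiseClass M₂)
    (k : ι) : ∫ p, (p.2 * φ k p.1) ^ 2 ∂(F.prod G) ≤ M₂ * v k := by
  have := hG.1
  simp only [mul_comm _ (φ k _), mul_pow]
  rw [integral_prod_mul (fun x => φ k x ^ 2) fun e => e ^ 2, h.integral_sq, mul_comm]
  exact mul_le_mul_of_nonneg_right hG.2.2.2 (h.nonneg k)

theorem lintegral_gramError_sq_le (hn : n ≠ 0) (h : IsOrthogonalDesign F φ v M) (hM : 0 ≤ M)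
    (G : Measure ℝ) [IsProbabilityMeasure G] (j k : ι) :
    ∫⁻ z, ENNReal.ofReal (gramError (fun k i => φ k (z i).1) v j k ^ 2)
        ∂(Measure.pi fun _ : Fin n => F.prod G)
      ≤ ENNReal.ofReal (M * (v j * v k) / n) := by
  have hmean : ∫ p, φ j p.1 * φ k p.1 ∂(F.prod G) = if j = k then v j else 0 := by
    rw [integral_fun_fst fun x => φ j x * φ k x, probReal_univ, one_smul, h.integral_mul]
  have hsq : ∫ p, (φ j p.1 * φ k p.1) ^ 2 ∂(F.prod G) ≤ M * (v j * v k) := by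
    rw [integral_fun_fst fun x => (φ j x * φ k x) ^ 2, probReal_univ, one_smul]
    exact h.integral_mul_sq_le hM j k
  simp only [gramError, ← hmean]
  exact (lintegral_sq_sampleMean_sub_integral_le hn _ ((h.memLp_mul j k).comp_fst G)).trans
    (ENNReal.ofReal_le_ofReal (div_le_div_of_nonneg_right hsq n.cast_nonneg))

variable [Countable ι]

theorem measure_not_gram_le (hn : n ≠ 0) (h : IsOrthogonalDesign F φ v M) (hM : 0 ≤ M)
    (G : Measure ℝ) [IsProbabilityMeasure G] (hw : ∀ k, 0 < w k)
    (hvw : Summable fun k => v k / w k) :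
    (Measure.pi fun _ : Fin n => F.prod G) {z | ¬∀ s : Finset (ι × ι),
        ∑ q ∈ s, gramError (fun k i => φ k (z i).1) v q.1 q.2 ^ 2 / (w q.1 * w q.2) ≤ 1 / 16}
      ≤ ENNReal.ofReal (16 * (M * (∑' k, v k / w k) ^ 2 / n)) := by
  have hratio : ∀ k, 0 ≤ v k / w k := fun k => div_nonneg (h.nonneg k) (hw k).le
  have hsum : HasSum (fun q : ι × ι => M * (v q.1 * v q.2) / n / (w q.1 * w q.2))
      (M / n * ((∑' k, v k / w k) * ∑' k, v k / w k)) := by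
    refine ((hvw.hasSum.mul hvw.hasSum
      (hvw.mul_of_nonneg hvw hratio hratio)).mul_left (M / n)).congr fun s => ?_
    field_simp
  have hmeas : ∀ q : ι × ι, Measurable fun z : Fin n → E × ℝ =>
      gramError (fun k i => φ k (z i).1) v q.1 q.2 := fun q => by
    have := h.measurable
    unfold gramError sampleMean
    fun_prop
  refine (measure_not_forall_sum_div_le _ hmeas (fun q => mul_pos (hw _) (hw _)) (fun q => ?_)
    (fun q => h.lintegral_gramError_sq_le hn hM G q.1 q.2) hsum.summable
    (by norm_num)).trans_eq ?_
  · exact div_nonneg (mul_nonneg hM (mul_nonneg (h.nonneg _) (h.nonneg _))) n.cast_nonneg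
  · rw [hsum.tsum_eq]
    ring_nf

theorem measure_not_score_le (hn : n ≠ 0) (h : IsOrthogonalDesign F φ v M)
    (hG : G ∈ noiseClass M₂) (hw : ∀ k, 0 < w k) (hvw : Summable fun k => v k / w k)
    (hζ : 0 < ζ) :
    (Measure.pi fun _ : Fin n => F.prod G) {z | ¬∀ s : Finset ι,
        ∑ k ∈ s, sampleMean (fun i => (z i).2 * φ k (z i).1) ^ 2 / w k ≤ ζ}
      ≤ ENNReal.ofReal (M₂ * (∑' k, v k / w k) / n / ζ) := by
  have := hG.1
  have hM₂ : 0 ≤ M₂ := (integral_nonneg fun e => sq_nonneg e).trans hG.2.2.2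
  have hsum : HasSum (fun k => M₂ * v k / n / w k) (M₂ * (∑' k, v k / w k) / n) := by
    simpa only [mul_div_assoc, div_right_comm _ (n : ℝ)] using
      (hvw.hasSum.mul_left M₂).div_const (n : ℝ)
  have hmeas := h.measurable
  refine (measure_not_forall_sum_div_le _ (c := fun k => M₂ * v k / n) (fun k => ?_) hw
    (fun k => ?_) (fun k => ?_) hsum.summable hζ).trans_eq (by rw [hsum.tsum_eq])
  · unfold sampleMean
    fun_prop
  · have := h.nonneg k
    positivity
  · refine le_trans (le_of_eq ?_) ((lintegral_sq_sampleMean_sub_integral_le hn (F.prod G)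
      (h.memLp_noise_mul hG k)).trans (ENNReal.ofReal_le_ofReal
        (div_le_div_of_nonneg_right (h.integral_noise_mul_sq_le hG k) n.cast_nonneg)))
    simp only [integral_noise_mul hG, sub_zero]

theorem measure_not_isRegularSample_le (hn : n ≠ 0) (h : IsOrthogonalDesign F φ v M)
    (hM : 0 ≤ M) (hG : G ∈ noiseClass M₂) (hw : ∀ k, 0 < w k)
    (hvw : Summable fun k => v k / w k) (hζ : 0 < ζ) :
    (Measure.pi fun _ : Fin n => F.prod G)
        {z | ¬IsRegularSample (fun k i => φ k (z i).1) (fun i => (z i).2) v w ζ}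
      ≤ ENNReal.ofReal (16 * (M * (∑' k, v k / w k) ^ 2 / n))
        + ENNReal.ofReal (M₂ * (∑' k, v k / w k) / n / ζ) := by
  have := hG.1
  refine le_trans (measure_mono ?_) ((measure_union_le _ _).trans
    (add_le_add (h.measure_not_gram_le hn hM G hw hvw) (h.measure_not_score_le hn hG hw hvw hζ)))
  intro z hz
  by_contra hgood
  simp only [Set.mem_union, Set.mem_ofPred_eq, not_or, not_not] at hgood
  exact hz ⟨fun s => hgood.1 (s ×ˢ s), hgood.2⟩

end IsOrthogonalDesign

end RegularSample

section RidgeRisk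

theorem hasSum_option {κ : Type*} {f : Option κ → ℝ} {a : ℝ}
    (h : HasSum (fun k => f (some k)) a) : HasSum f (f none + a) := by
  classical
  have hsome : HasSum (fun o => if o = none then 0 else f o) a := by
    refine ((Option.some_injective κ).hasSum_iff ?_).1 (by simpa [Function.comp_def] using h)
    rintro (_ | k) hk
    · simp
    · exact absurd ⟨k, rfl⟩ hk
  convert (hasSum_ite_eq none (f none)).add hsome using 2 with o
  split_ifs with ho <;> simp [ho]

theorem sampleMean_sub_sq {n : ℕ} (ε f : Fin n → ℝ) :
    sampleMean (fun i => (ε i - f i) ^ 2) = sampleMean (fun i => ε i ^ 2)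
      - 2 * sampleMean (fun i => ε i * f i) + sampleMean fun i => f i ^ 2 := by
  simp only [sampleMean, sub_sq, Finset.sum_add_distrib, Finset.sum_sub_distrib, mul_assoc,
    ← Finset.mul_sum]
  ring

variable {E : Type*} [NormedAddCommGroup E] [InnerProductSpace ℝ E]

/-- The features of the linear model with intercept: `none` stands for the intercept, and `some k`
for the coordinate of `x - m` along `ψ k`. -/
noncomputable def feature (m : E) (ψ : ℕ → E) (o : Option ℕ) (x : E) : ℝ :=
  o.elim 1 fun k => ⟪ψ k, x - m⟫

variable [CompleteSpace E] {H : Type*} [NormedAddCommGroup H] [InnerProductSpace ℝ H]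
  [CompleteSpace H] {ι : H →L[ℝ] E} {ρ μ : ℕ → ℝ} {ψ : ℕ → E}

theorem hasSum_mul_feature (hψ : IsEigenSystem (ι ∘L ι.adjoint) ρ ψ) (m : E) (c : ℝ) (Δ : H)
    (x : E) :
    HasSum (fun o : Option ℕ => o.elim (c + ⟪m, ι Δ⟫) (fun k => ⟪ψ k, ι Δ⟫) * feature m ψ o x)
      (c + ⟪x, ι Δ⟫) := by
  have hcoord := (hψ.hasSum_of_range Δ).mapL (innerSL ℝ (x - m))
  simp only [innerSL_apply_apply, inner_smul_right, real_inner_comm (ψ _) (x - m)] at hcoord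
  convert hasSum_option (f := fun o : Option ℕ =>
    o.elim (c + ⟪m, ι Δ⟫) (fun k => ⟪ψ k, ι Δ⟫) * feature m ψ o x) hcoord using 1
  simp only [feature, Option.elim_none, inner_sub_left]
  ring

theorem tsum_inner_sub_sq_div_le (hψ : IsEigenSystem (ι ∘L ι.adjoint) ρ ψ) (hρ : ∀ k, 0 < ρ k)
    (b β₀ : H) : ∑' k, ⟪ψ k, ι (b - β₀)⟫ ^ 2 / ρ k ≤ 2 * (‖b‖ ^ 2 + ‖β₀‖ ^ 2) := by
  have hparallelogram := parallelogram_law_with_norm ℝ b β₀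
  have hle := hψ.tsum_inner_sq_div_le hρ (b - β₀)
  nlinarith [mul_self_nonneg ‖b + β₀‖]

theorem IsEigenSystem.summable_mul_inner_sq (hψ : IsEigenSystem (ι ∘L ι.adjoint) ρ ψ)
    (hμ : ∀ k, 0 ≤ μ k) (hanti : Antitone μ) (Δ : H) :
    Summable fun k => μ k * ⟪ψ k, ι Δ⟫ ^ 2 :=
  .of_nonneg_of_le (fun k => mul_nonneg (hμ k) (sq_nonneg _))
    (fun k => mul_le_mul_of_nonneg_right (hanti k.zero_le) (sq_nonneg _))
    ((hψ.hasSum_inner_sq Δ).summable.mul_left (μ 0))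

theorem mul_norm_sub_sq_le_of_isRegularSample {n : ℕ} {lam κ ζ : ℝ}
    (hψ : IsEigenSystem (ι ∘L ι.adjoint) ρ ψ) (hρ : ∀ k, 0 < ρ k) (hμ : ∀ k, 0 < μ k)
    (hanti : Antitone μ) (hlam : 0 < lam) (hκ : ∀ k, κ ≤ μ k + lam / ρ k) {m : E}
    {x : Fin n → E} {ε : Fin n → ℝ}
    (hreg : IsRegularSample (fun o i => feature m ψ o (x i)) ε (fun o => o.elim 1 μ)
      (fun o => o.elim 1 μ + o.elim 0 fun k => lam / ρ k) ζ) {c : ℝ} {b β₀ : H}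
    (hmin : sampleMean (fun i => (ε i - (c + ⟪x i, ι (b - β₀)⟫)) ^ 2) + lam * ‖b‖ ^ 2
      ≤ sampleMean (fun i => ε i ^ 2) + lam * ‖β₀‖ ^ 2) :
    κ * ‖ι (b - β₀)‖ ^ 2 ≤ 64 * ζ + 16 * (lam * ‖β₀‖ ^ 2) := by
  set Δ := b - β₀
  set d : Option ℕ → ℝ := fun o => o.elim (c + ⟪m, ι Δ⟫) fun k => ⟪ψ k, ι Δ⟫
  have hL2 := hψ.hasSum_inner_sq Δ
  have hvd := hψ.summable_mul_inner_sq (fun k => (hμ k).le) hanti Δ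
  have had : HasSum (fun k => lam / ρ k * ⟪ψ k, ι Δ⟫ ^ 2)
      (lam * ∑' k, ⟪ψ k, ι Δ⟫ ^ 2 / ρ k) := by
    simpa only [mul_div_assoc, div_mul_eq_mul_div] using
      (hψ.summable_inner_sq_div hρ Δ).hasSum.mul_left lam
  have hvd' := hasSum_option (f := fun o => o.elim 1 μ * d o ^ 2) hvd.hasSum
  have had' := hasSum_option (f := fun o => (o.elim 0 fun k => lam / ρ k) * d o ^ 2) had
  have hbasic : ∑' o, (o.elim 1 μ + o.elim 0 fun k => lam / ρ k) * d o ^ 2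
      ≤ 64 * ζ + 8 * (2 * (lam * ‖β₀‖ ^ 2)) := by
    refine hreg.tsum_mul_sq_le ?_ ?_ ?_ hvd'.summable had'.summable
      (fun i => hasSum_mul_feature hψ m c Δ (x i)) ?_
    · rintro (_ | k)
      exacts [zero_le_one, (hμ k).le]
    · rintro (_ | k)
      exacts [le_rfl, (div_pos hlam (hρ k)).le]
    · rintro (_ | k)
      exacts [by norm_num, add_pos (hμ k) (div_pos hlam (hρ k))]
    · rw [had'.tsum_eq]
      rw [sampleMean_sub_sq] at hmin
      have hpen := mul_le_mul_of_nonneg_left (tsum_inner_sub_sq_div_le hψ hρ b β₀) hlam.le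
      simp only [Option.elim_none, zero_mul, zero_add]
      linarith
  have hwd := hvd'.add had'
  simp only [← add_mul] at hwd
  rw [hwd.tsum_eq] at hbasic
  have hle : κ * ‖ι Δ‖ ^ 2 ≤ ∑' k, μ k * ⟪ψ k, ι Δ⟫ ^ 2 + lam * ∑' k, ⟪ψ k, ι Δ⟫ ^ 2 / ρ k := by
    refine hasSum_le (fun k => ?_) (hL2.mul_left κ) (hvd.hasSum.add had)
    rw [← add_mul]
    exact mul_le_mul_of_nonneg_right (hκ k) (sq_nonneg _)
  simp only [Option.elim_none, one_mul, zero_mul] at hbasic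
  linarith [sq_nonneg (d none)]

end RidgeRisk

section FeatureDesign

variable {T : Type*} [MeasurableSpace T] {τ : Measure T} {F : Measure (L2 τ)}
  [IsProbabilityMeasure F] {μ : ℕ → ℝ} {ψ : ℕ → L2 τ} {M : ℝ}

theorem integral_inner_sub_integral (hF : MemLp id 2 F) (f : L2 τ) :
    ∫ x, ⟪f, x - ∫ x', x' ∂F⟫ ∂F = 0 := by
  have hint : Integrable (fun x : L2 τ => x) F := hF.integrable one_le_two
  have h := integral_inner (𝕜 := ℝ) (hint.sub (integrable_const (∫ x', x' ∂F))) f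
  simp only [Pi.sub_apply, integral_sub hint (integrable_const _), integral_const, probReal_univ,
    one_smul, sub_self, inner_zero_right] at h
  exact h

theorem integral_inner_mul_inner (hF : MemLp id 2 F) (hψ : IsEigenSystem (covOp F) μ ψ)
    (j k : ℕ) : ∫ x, ⟪ψ j, x - ∫ x', x' ∂F⟫ * ⟪ψ k, x - ∫ x', x' ∂F⟫ ∂F
      = if j = k then μ j else 0 := by
  have hcov := inner_covOp (F := F) (ψ j) (ψ k)
  rw [hψ.apply_eq, inner_smul_left, orthonormal_iff_ite.1 hψ.orthonormal,
    covarianceBilin_apply hF] at hcov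
  simpa using hcov.symm

theorem integral_inner_eigenvector_sq (hF : MemLp id 2 F)
    (hmean : ∫ x, x ∂F = 0) (h : IsEigenSystem (covOp F) μ ψ) (k : ℕ) :
    ∫ x, ⟪x, ψ k⟫ ^ 2 ∂F = μ k := by
  simpa [hmean, sq, real_inner_comm] using integral_inner_mul_inner hF h k k

theorem isOrthogonalDesign_feature (hF : MemLp id 2 F) (hψ : IsEigenSystem (covOp F) μ ψ)
    (h4 : ∀ k, Integrable (fun x => ⟪ψ k, x - ∫ x', x' ∂F⟫ ^ 4) F ∧
      ∫ x, ⟪ψ k, x - ∫ x', x' ∂F⟫ ^ 4 ∂F ≤ M * (∫ x, ⟪ψ k, x - ∫ x', x' ∂F⟫ ^ 2 ∂F) ^ 2) :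
    IsOrthogonalDesign F (feature (∫ x', x' ∂F) ψ) (fun o => o.elim 1 μ) (max M 1) where
  measurable := by
    rintro (_ | k)
    · exact measurable_const
    · have hcont : Continuous fun x => ⟪ψ k, x - ∫ x', x' ∂F⟫ := by fun_prop
      exact hcont.measurable
  memLp := by
    rintro (_ | k)
    · exact memLp_const 1
    · have hcont : Continuous fun x => ⟪ψ k, x - ∫ x', x' ∂F⟫ := by fun_prop
      refine (integrable_norm_rpow_iff hcont.aestronglyMeasurable (by norm_num) (by norm_num)).1 ?_
      refine (h4 k).1.congr (ae_of_all _ fun x => ?_)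
      norm_num [Real.norm_eq_abs, Even.pow_abs (show Even 4 by decide)]
  integral_mul := by
    rintro (_ | j) (_ | k)
    · simp [feature]
    · simpa [feature] using integral_inner_sub_integral hF (ψ k)
    · simpa [feature] using integral_inner_sub_integral hF (ψ j)
    · simpa [feature] using integral_inner_mul_inner hF hψ j k
  integral_pow_four_le := by
    rintro (_ | k)
    · simp [feature]
    · have hsq := integral_inner_mul_inner hF hψ k k
      simp only [if_true, ← sq] at hsq
      refine (h4 k).2.trans ?_
      rw [hsq]
      exact mul_le_mul_of_nonneg_right (le_max_left _ _) (sq_nonneg _)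

variable [SecondCountableTopology (L2 τ)] {H : Type*} [NormedAddCommGroup H]
  [InnerProductSpace ℝ H] [CompleteSpace H] [RKHS ℝ H T ℝ] {hH : ∀ f : H, MemLp (f : T → ℝ) 2 τ}
  {H₀ : Submodule ℝ H} [H₀.HasOrthogonalProjection]

theorem dataLaw_lt_norm_sub_sq_le (h0 : H₀ = ⊥) {ρ : ℕ → ℝ}
    (hψ : IsEigenSystem (embedding hH ∘L (embedding hH).adjoint) ρ ψ) (hρ : ∀ k, 0 < ρ k)
    (hμ : ∀ k, 0 < μ k) (hanti : Antitone μ) {m : L2 τ} (hM : 0 ≤ M)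
    (hF : IsOrthogonalDesign F (feature m ψ) (fun o => o.elim 1 μ) M) {G : Measure ℝ} {M₂ : ℝ}
    (hG : G ∈ noiseClass M₂) {n : ℕ} (hn : n ≠ 0) {lam κ S ζ u : ℝ} (hlam : 0 < lam)
    (hκ0 : 0 < κ) (hκ : ∀ k, κ ≤ μ k + lam / ρ k) (hζ : 0 < ζ)
    (hS : HasSum (fun k => μ k / (μ k + lam / ρ k)) S) (α₀ : ℝ) {β₀ : H}
    {b : (Fin n → L2 τ × ℝ) → H} (hbm : Measurable fun z => toL2 hH (b z))
    (hb : ∀ z, IsRegularizedSlope hH H₀ n lam z (b z))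
    (hu : κ⁻¹ * (64 * ζ + 16 * (lam * J H₀ β₀)) ≤ u) :
    dataLaw n α₀ (toL2 hH β₀) F G {z | u < ‖toL2 hH (b z) - toL2 hH β₀‖ ^ 2}
      ≤ ENNReal.ofReal (16 * (M * (1 + S) ^ 2 / n))
        + ENNReal.ofReal (M₂ * (1 + S) / n / ζ) := by
  have := hG.1
  set w : Option ℕ → ℝ := fun o => o.elim 1 μ + o.elim 0 fun k => lam / ρ k
  have hw : ∀ o, 0 < w o := by
    rintro (_ | k)
    exacts [by norm_num [w], add_pos (hμ k) (div_pos hlam (hρ k))]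
  have hS' : HasSum (fun o => o.elim 1 μ / w o) (1 + S) := by
    simpa [w] using hasSum_option (f := fun o : Option ℕ => o.elim 1 μ / w o) hS
  have hbad := hF.measure_not_isRegularSample_le hn hM hG hw hS'.summable hζ
  rw [hS'.tsum_eq] at hbad
  rw [dataLaw_apply _ _ _ _ (measurableSet_lt measurable_const (by fun_prop))]
  refine (measure_mono fun z hz hreg => ?_).trans hbad
  set z' : Fin n → L2 τ × ℝ := fun i => ((z i).1, α₀ + ⟪(z i).1, toL2 hH β₀⟫ + (z i).2)
  obtain ⟨α, hα⟩ := hb z'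
  have hmin := hα α₀ β₀
  simp only [criterion, J_eq_norm_sq h0, ← embedding_apply] at hmin
  have hres : ∀ i, (z' i).2 - (α + ⟪(z' i).1, embedding hH (b z')⟫)
      = (z i).2 - (α - α₀ + ⟪(z i).1, embedding hH (b z' - β₀)⟫) := fun i => by
    simp only [z', map_sub, inner_sub_right, embedding_apply]
    ring
  have hnoise : ∀ i, (z' i).2 - (α₀ + ⟪(z' i).1, embedding hH β₀⟫) = (z i).2 := fun i => by
    simp only [z', embedding_apply]
    ring
  simp only [hres, hnoise] at hmin
  have hle := mul_norm_sub_sq_le_of_isRegularSample hψ hρ hμ hanti hlam hκ hreg hmin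
  rw [map_sub, embedding_apply, embedding_apply, ← J_eq_norm_sq h0] at hle
  refine not_le.2 hz (le_trans ?_ hu)
  rwa [inv_mul_eq_div, le_div_iff₀' hκ0]

end FeatureDesign

section Rates

theorem exists_const_mul_le_of_isTheta {f g : ℕ → ℝ} (h : f =Θ[atTop] g) (hf : ∀ k, 0 < f k)
    (hg : ∀ k, 0 ≤ g k) :
    ∃ c C : ℝ, 0 < c ∧ 0 < C ∧ ∀ k, g k ≠ 0 → c * g k ≤ f k ∧ f k ≤ C * g k := by
  obtain ⟨C, hC, hfg⟩ := Asymptotics.bound_of_isBigO_nat_atTop h.1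
  obtain ⟨c, hc, hgf⟩ := Asymptotics.bound_of_isBigO_nat_atTop h.2
  refine ⟨c⁻¹, C, inv_pos.2 hc, hC, fun k hk => ⟨?_, ?_⟩⟩
  · simpa [inv_mul_le_iff₀ hc, abs_of_nonneg (hg k), abs_of_pos (hf k)] using hgf (hf k).ne'
  · simpa [abs_of_nonneg (hg k), abs_of_pos (hf k)] using hfg hk

theorem sum_add_rpow_neg_le {L p : ℝ} (hL : 0 < L) (hp : 1 < p) (n : ℕ) :
    ∑ k ∈ Finset.range n, (L + ((k : ℝ) + 1)) ^ (-p) ≤ L ^ (1 - p) / (p - 1) := by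
  have hanti : AntitoneOn (fun x : ℝ => x ^ (-p)) (Set.Icc L (L + n)) := fun x hx y _ hxy =>
    Real.rpow_le_rpow_of_nonpos (hL.trans_le hx.1) hxy (by linarith)
  have hint : ∫ x in L..L + n, x ^ (-p) = (L ^ (1 - p) - (L + n) ^ (1 - p)) / (p - 1) := by
    rw [integral_rpow (.inr ⟨by linarith, by simp [hL]⟩), neg_add_eq_sub,
      ← neg_div_neg_eq, neg_sub, neg_sub]
  calc ∑ k ∈ Finset.range n, (L + ((k : ℝ) + 1)) ^ (-p)
      ≤ (L ^ (1 - p) - (L + n) ^ (1 - p)) / (p - 1) := by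
        simpa only [hint, Nat.cast_add, Nat.cast_one] using hanti.sum_le_integral
    _ ≤ L ^ (1 - p) / (p - 1) :=
        div_le_div_of_nonneg_right (sub_le_self _ (by positivity)) (by linarith)

theorem mul_le_mul_rpow_neg_add {x a c q q' u w : ℝ} (hx : 0 < x) (hu : 0 ≤ u) (hw : 0 ≤ w)
    (hua : u ≤ a * x ^ (-q)) (hwc : w ≤ c * x ^ (-q')) :
    u * w ≤ a * c * x ^ (-(q' + q)) := calc
  u * w ≤ a * x ^ (-q) * (c * x ^ (-q')) := mul_le_mul hua hwc hw (hu.trans hua)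
  _ = a * c * x ^ (-(q' + q)) := by
    rw [neg_add, Real.rpow_add hx]
    ring

variable {μ ρ : ℕ → ℝ} {D p h : ℝ}

theorem div_add_div_le_mul_rpow (hμ : ∀ k, 0 < μ k) (hρ : ∀ k, 0 < ρ k) (hD : 1 ≤ D)
    (hμρ : ∀ k : ℕ, μ k * ρ k ≤ D * ((k : ℝ) + 1) ^ (-p)) (hp : 0 ≤ p) (hh : 0 < h) (k : ℕ) :
    μ k / (μ k + h ^ p / ρ k) ≤ D * (2 / h) ^ p * (h⁻¹ + ((k : ℝ) + 1)) ^ (-p) := by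
  set x : ℝ := (k : ℝ) + 1
  have hx : 0 < x := by positivity
  have hw : 0 < h ^ p / ρ k := div_pos (Real.rpow_pos_of_pos hh _) (hρ k)
  have hrhs : D * (2 / h) ^ p * (h⁻¹ + x) ^ (-p) = D * (2 / (1 + h * x)) ^ p := by
    rw [Real.rpow_neg (by positivity), ← Real.inv_rpow (by positivity), mul_assoc,
      ← Real.mul_rpow (by positivity) (by positivity)]
    congr 2
    field_simp
  rw [hrhs]
  rcases le_or_gt (h * x) 1 with hhx | hhx
  · refine ((div_le_one (add_pos (hμ k) hw)).2 (le_add_of_nonneg_right hw.le)).trans ?_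
    refine one_le_mul_of_one_le_of_one_le hD (Real.one_le_rpow ?_ hp)
    rw [one_le_div (by positivity)]
    linarith
  · calc μ k / (μ k + h ^ p / ρ k)
        ≤ μ k / (h ^ p / ρ k) :=
          div_le_div_of_nonneg_left (hμ k).le hw (le_add_of_nonneg_left (hμ k).le)
      _ = μ k * ρ k / h ^ p := div_div_eq_mul_div _ _ _
      _ ≤ D * x ^ (-p) / h ^ p := div_le_div_of_nonneg_right (hμρ k) (by positivity)
      _ = D * (1 / (h * x)) ^ p := by
          rw [one_div, Real.inv_rpow (by positivity), Real.mul_rpow hh.le hx.le,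
            Real.rpow_neg hx.le]
          field_simp
      _ ≤ D * (2 / (1 + h * x)) ^ p := by
          have hle : 1 / (h * x) ≤ 2 / (1 + h * x) := by
            rw [div_le_div_iff₀ (by positivity) (by positivity)]
            linarith
          gcongr

theorem summable_div_add_div_and_tsum_le (hμ : ∀ k, 0 < μ k) (hρ : ∀ k, 0 < ρ k) (hD : 1 ≤ D)
    (hμρ : ∀ k : ℕ, μ k * ρ k ≤ D * ((k : ℝ) + 1) ^ (-p)) (hp : 1 < p) (hh : 0 < h) :
    (Summable fun k => μ k / (μ k + h ^ p / ρ k)) ∧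
      ∑' k, μ k / (μ k + h ^ p / ρ k) ≤ D * 2 ^ p / (p - 1) * h⁻¹ := by
  have hpartial : ∀ n, ∑ k ∈ Finset.range n, μ k / (μ k + h ^ p / ρ k)
      ≤ D * 2 ^ p / (p - 1) * h⁻¹ := fun n => calc
    ∑ k ∈ Finset.range n, μ k / (μ k + h ^ p / ρ k)
      ≤ ∑ k ∈ Finset.range n, D * (2 / h) ^ p * (h⁻¹ + ((k : ℝ) + 1)) ^ (-p) :=
        Finset.sum_le_sum fun k _ =>
          div_add_div_le_mul_rpow hμ hρ hD hμρ (by linarith) hh k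
    _ ≤ D * (2 / h) ^ p * (h⁻¹ ^ (1 - p) / (p - 1)) := by
        rw [← Finset.mul_sum]
        gcongr
        exact sum_add_rpow_neg_le (inv_pos.2 hh) hp n
    _ = D * 2 ^ p / (p - 1) * h⁻¹ := by
        rw [Real.div_rpow zero_le_two hh.le, Real.rpow_sub (inv_pos.2 hh), Real.rpow_one,
          Real.inv_rpow hh.le]
        field_simp
  have hnonneg : ∀ k, 0 ≤ μ k / (μ k + h ^ p / ρ k) := fun k =>
    div_nonneg (hμ k).le (add_pos (hμ k) (div_pos (Real.rpow_pos_of_pos hh _) (hρ k))).le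
  exact ⟨summable_of_sum_range_le hnonneg hpartial, Real.tsum_le_of_sum_range_le hnonneg hpartial⟩

theorem min_mul_rpow_le_add_div {a c q q' : ℝ} (ha : 0 < a) (hc : 0 < c) (hμ : ∀ k, 0 < μ k)
    (hρ : ∀ k, 0 < ρ k) (hμa : ∀ k : ℕ, a * ((k : ℝ) + 1) ^ (-q) ≤ μ k)
    (hρc : ∀ k : ℕ, ρ k ≤ c * ((k : ℝ) + 1) ^ (-q')) (hq : 0 ≤ q) (hq' : 0 ≤ q') (hh : 0 < h)
    (k : ℕ) : min a c⁻¹ * h ^ q ≤ μ k + h ^ (q' + q) / ρ k := by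
  set x : ℝ := (k : ℝ) + 1
  have hx : 0 < x := by positivity
  rcases le_or_gt (h * x) 1 with hhx | hhx
  · have hhx' : h ≤ x⁻¹ := by rwa [← one_div, le_div_iff₀ hx]
    calc min a c⁻¹ * h ^ q ≤ a * x⁻¹ ^ q := by gcongr; exact min_le_left _ _
      _ = a * x ^ (-q) := by rw [Real.rpow_neg hx.le, Real.inv_rpow hx.le]
      _ ≤ μ k := hμa k
      _ ≤ μ k + h ^ (q' + q) / ρ k :=
        le_add_of_nonneg_right (div_pos (Real.rpow_pos_of_pos hh _) (hρ k)).le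
  · have hhx' : x⁻¹ ≤ h := by rw [← one_div, div_le_iff₀ hx]; exact hhx.le
    have hρh : ρ k ≤ c * h ^ q' := calc
      ρ k ≤ c * x⁻¹ ^ q' := by rw [Real.inv_rpow hx.le, ← Real.rpow_neg hx.le]; exact hρc k
      _ ≤ c * h ^ q' := by gcongr
    calc min a c⁻¹ * h ^ q ≤ c⁻¹ * h ^ q := by gcongr; exact min_le_right _ _
      _ = h ^ (q' + q) / (c * h ^ q') := by
        rw [Real.rpow_add hh]
        field_simp
      _ ≤ h ^ (q' + q) / ρ k := by gcongr; exact hρ k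
      _ ≤ μ k + h ^ (q' + q) / ρ k := le_add_of_nonneg_left (hμ k).le

theorem exists_nat_le_pow_and_le {K p : ℝ} (hK : 1 ≤ K) (hp : 0 ≤ p) {n : ℕ} (hn : n ≠ 0) :
    ∃ m : ℕ, 0 < m ∧ K * n ≤ (m : ℝ) ^ (p + 1) ∧ (m : ℝ) ≤ 2 * (K * (n : ℝ) ^ (1 / (p + 1))) := by
  have hn1 : (1 : ℝ) ≤ n := by exact_mod_cast Nat.one_le_iff_ne_zero.2 hn
  set N : ℝ := (n : ℝ) ^ (1 / (p + 1))
  have hKN : 1 ≤ K * N :=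
    one_le_mul_of_one_le_of_one_le hK (Real.one_le_rpow hn1 (by positivity))
  refine ⟨⌈K * N⌉₊, Nat.ceil_pos.2 (by linarith), ?_, ?_⟩
  · calc K * n ≤ K ^ (p + 1) * N ^ (p + 1) := by
          rw [← Real.rpow_mul (by positivity), one_div_mul_cancel (by positivity), Real.rpow_one]
          gcongr
          exact Real.self_le_rpow_of_one_le hK (le_add_of_nonneg_left hp)
      _ = (K * N) ^ (p + 1) := (Real.mul_rpow (by positivity) (by positivity)).symm
      _ ≤ (⌈K * N⌉₊ : ℝ) ^ (p + 1) := by gcongr; exact Nat.le_ceil _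
  · have := Nat.ceil_lt_add_one (show 0 ≤ K * N by linarith)
    linarith

end Rates

section Classes

theorem integral_map_const_add {E : Type*} [NormedAddCommGroup E] [NormedSpace ℝ E]
    [CompleteSpace E] [MeasurableSpace E] [BorelSpace E] [SecondCountableTopology E]
    {P : Measure E} [IsProbabilityMeasure P] (hP : Integrable (fun x => x) P) (m : E) :
    ∫ x, x ∂(P.map (m + ·)) = m + ∫ x, x ∂P := by
  have hmap := integral_map (μ := P) (φ := fun x => m + x) (f := fun x => x) (by fun_prop)
    aestronglyMeasurable_id
  simpa [integral_add (integrable_const m) hP] using hmap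

variable {T : Type*} [MeasurableSpace T] {τ : Measure T}
  {H : Type*} [NormedAddCommGroup H] [InnerProductSpace ℝ H] [RKHS ℝ H T ℝ]
  {hH : ∀ f : H, MemLp (f : T → ℝ) 2 τ} {H₀ : Submodule ℝ H} [H₀.HasOrthogonalProjection]
  {ρ μ : ℕ → ℝ} {ψ : ℕ → L2 τ} {s M A M₂ : ℝ} {F : Measure (L2 τ)}

theorem covOp_eigenvalue_nonneg (h : IsEigenSystem (covOp F) μ ψ) (k : ℕ) : 0 ≤ μ k := by
  simpa [h.inner_eigenvector_apply, h.orthonormal.1 k, h.apply_eq, inner_smul_left]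
    using inner_covOp_self_nonneg (F := F) (ψ k)

theorem gaussianReal_mem_noiseClass (hM₂ : 0 ≤ M₂) :
    gaussianReal 0 M₂.toNNReal ∈ noiseClass M₂ := by
  refine ⟨inferInstance, memLp_id_gaussianReal 2, integral_id_gaussianReal, ?_⟩
  have h := variance_id_gaussianReal (μ := 0) (v := M₂.toNNReal)
  rw [variance_of_integral_eq_zero aemeasurable_id integral_id_gaussianReal] at h
  exact (h.trans (Real.coe_toNNReal _ hM₂)).le

theorem dataLaw_le_worstProb {n : ℕ} (α₀ : ℝ) {𝓕 : Set (Measure (L2 τ))} {𝓖 : Set (Measure ℝ)}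
    {𝓑 : Set H} {G : Measure ℝ} {β₀ : H} (hF : F ∈ 𝓕) (hG : G ∈ 𝓖) (hβ₀ : β₀ ∈ 𝓑)
    (b : (Fin n → L2 τ × ℝ) → L2 τ) (u : ℝ) :
    dataLaw n α₀ (toL2 hH β₀) F G {z | u < ‖b z - toL2 hH β₀‖ ^ 2}
      ≤ worstProb hH n α₀ 𝓕 𝓖 𝓑 b u :=
  le_iSup₂_of_le F hF (le_iSup₂_of_le G hG (le_iSup₂_of_le β₀ hβ₀ le_rfl))

variable [TopologicalSpace T]

theorem ProcessClass.const_pos (h : ProcessClass hH H₀ ρ s M A F) : 0 < A := by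
  obtain ⟨μ, φ, γ, hφ, hμ, hγ, hγρ⟩ := h.decay
  by_contra! hA
  have hμ0 := covOp_eigenvalue_nonneg hφ 0
  have hle : μ 0 ≤ A := by simpa using (hμ 0).2
  have hA0 : A = 0 := le_antisymm hA (hμ0.trans hle)
  exact (hγ.1 0).not_ge (by simpa [hA0] using (hγρ 0).2)

theorem ProcessClass.nullSpace_eq_bot (h : ProcessClass hH H₀ ρ s M A F) : H₀ = ⊥ := by
  obtain ⟨μ, φ, γ, -, -, hγ, -⟩ := h.decay
  exact FLR.nullSpace_eq_bot h.nondegenerate hγ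

theorem commonClass.exists_eigenvalues (h : F ∈ commonClass hH H₀ ρ ψ s M A) :
    ∃ μ : ℕ → ℝ, IsEigenSystem (covOp F) μ ψ ∧ (∀ k, 0 < μ k) ∧
      ∀ k : ℕ, A⁻¹ * ((k : ℝ) + 1) ^ (-(2 * s)) ≤ μ k ∧
        μ k ≤ A * ((k : ℝ) + 1) ^ (-(2 * s)) := by
  obtain ⟨hF, μ, hμ⟩ := h
  obtain ⟨μ', φ, -, hφ, hμ', -, -⟩ := hF.decay
  obtain rfl := hμ.eigenvalue_unique hφ (covOp_eigenvalue_nonneg hμ) (covOp_eigenvalue_nonneg hφ)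
  have hA := hF.const_pos
  simp only [neg_mul] at hμ'
  exact ⟨μ, hμ, fun k => lt_of_lt_of_le (by positivity) (hμ' k).1, hμ'⟩

variable [SecondCountableTopology (L2 τ)]

theorem ProcessClass.map_const_add (h : ProcessClass hH H₀ ρ s M A F) (m : L2 τ) :
    ProcessClass hH H₀ ρ s M A (F.map (m + ·)) := by
  have := h.prob
  have hmeas : AEMeasurable (fun x : L2 τ => m + x) F := by fun_prop
  have hcov : covOp (F.map (m + ·)) = covOp F := by rw [covOp, covarianceBilin_map_const_add, covOp]
  refine ⟨Measure.isProbabilityMeasure_map hmeas, ?_, hcov ▸ h.continuous_cov,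
    hcov ▸ h.nondegenerate, fun f => ?_, hcov ▸ h.decay⟩
  · rw [memLp_map_measure_iff aestronglyMeasurable_id hmeas]
    exact (memLp_const m).add h.memLp
  · rw [integral_map_const_add (h.memLp.integrable one_le_two),
      integrable_map_measure (by fun_prop) hmeas, integral_map hmeas (by fun_prop),
      integral_map hmeas (by fun_prop)]
    simpa only [Function.comp_def, add_sub_add_left_eq_sub] using h.fourth_moment f

theorem commonClass.exists_integral_eq_zero (h : F ∈ commonClass hH H₀ ρ ψ s M A) :
    ∃ F' ∈ commonClass hH H₀ ρ ψ s M A, ∫ x, x ∂F' = 0 := by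
  have := h.1.prob
  refine ⟨F.map ((-∫ x, x ∂F) + ·), ⟨h.1.map_const_add _, ?_⟩, ?_⟩
  · rw [covOp, covarianceBilin_map_const_add]
    exact h.2
  · rw [integral_map_const_add (h.1.memLp.integrable one_le_two), neg_add_cancel]

end Classes

section LowerBound

theorem mul_div_mul_le_of_mul_le_rpow {m n x B K V a c q q' u w : ℝ} (hm : 0 < m) (hn : 0 ≤ n)
    (hB : 0 ≤ B) (ha : 0 ≤ a) (hc : 0 ≤ c) (hV : 0 ≤ V) (hq : 0 ≤ q' + q) (hmx : m ≤ x)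
    (hu : 0 ≤ u) (hw : 0 ≤ w) (hua : u ≤ a * x ^ (-q)) (hwc : w ≤ c * x ^ (-q'))
    (hKV : B * (a * c) ≤ V * K) (hKn : K * n ≤ m ^ (q' + q + 1)) :
    n * (B * w / m * u) ≤ V := calc
  n * (B * w / m * u) = n * B / m * (u * w) := by ring
  _ ≤ n * B / m * (a * c * x ^ (-(q' + q))) :=
    mul_le_mul_of_nonneg_left (mul_le_mul_rpow_neg_add (hm.trans_le hmx) hu hw hua hwc)
      (by positivity)
  _ ≤ n * B / m * (a * c * m ^ (-(q' + q))) := by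
    gcongr _ * (_ * ?_)
    exact Real.rpow_le_rpow_of_nonpos hm hmx (by linarith)
  _ = B * (a * c) * n / m ^ (q' + q + 1) := by
    rw [Real.rpow_neg hm.le, Real.rpow_add_one hm.ne']
    field_simp
  _ ≤ V := by
    rw [div_le_iff₀ (by positivity)]
    calc B * (a * c) * n ≤ V * K * n := by gcongr
      _ = V * (K * n) := mul_assoc _ _ _
      _ ≤ V * m ^ (q' + q + 1) := by gcongr

theorem const_mul_rpow_le_of_le_two_mul {x y K N q a : ℝ} (hx : 0 < x) (hN : 0 < N) (hK : 0 < K)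
    (ha : 0 ≤ a) (hq : 0 ≤ q) (hxN : x ≤ 2 * (K * N)) (hy : a * (2 * x) ^ (-q) ≤ y) :
    a * (4 * K) ^ (-q) * N ^ (-q) ≤ y := by
  refine le_trans ?_ hy
  rw [mul_assoc, ← Real.mul_rpow (by positivity) hN.le]
  exact mul_le_mul_of_nonneg_left
    (Real.rpow_le_rpow_of_nonpos (by positivity) (by linarith) (by linarith)) ha

variable {T : Type*} [MeasurableSpace T] {τ : Measure T} [SecondCountableTopology (L2 τ)]
  {H : Type*} [NormedAddCommGroup H] [InnerProductSpace ℝ H] [CompleteSpace H] [RKHS ℝ H T ℝ]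
  {hH : ∀ f : H, MemLp (f : T → ℝ) 2 τ} {H₀ : Submodule ℝ H} [H₀.HasOrthogonalProjection]
  {ρ μ : ℕ → ℝ} {ψ : ℕ → L2 τ} {F : Measure (L2 τ)}

theorem exists_norm_sq_le_and_le_dataLaw
    (hψ : IsEigenSystem (embedding hH ∘L (embedding hH).adjoint) ρ ψ) (hρ : ∀ k, 0 < ρ k)
    [IsProbabilityMeasure F] (hF : MemLp id 2 F) (hmean : ∫ x, x ∂F = 0)
    (hμ : IsEigenSystem (covOp F) μ ψ) (α₀ : ℝ) {v : NNReal} (hv : v ≠ 0) {B κ : ℝ} (hB : 0 ≤ B)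
    (hκ0 : 0 < κ) {m n : ℕ} (hm : 0 < m) {σ : Fin m → ℕ} (hσ : Function.Injective σ)
    (hκ : ∀ j, κ ≤ B * ρ (σ j) / m) (hdist : ∀ j, n * (B * ρ (σ j) / m * μ (σ j)) ≤ 4 * v)
    {b : (Fin n → L2 τ × ℝ) → L2 τ} (hb : Measurable b) :
    ∃ β : H, ‖β‖ ^ 2 ≤ B ∧ 1 / 32 ≤ (dataLaw n α₀ (toL2 hH β) F (gaussianReal 0 v)).real
      {z | κ * m / 128 < ‖b z - toL2 hH β‖ ^ 2} := by
  set c : Fin m → ℝ := fun j => √(B * ρ (σ j) / m)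
  have hc : ∀ j, c j ^ 2 = B * ρ (σ j) / m := fun j =>
    Real.sq_sqrt (div_nonneg (mul_nonneg hB (hρ _).le) m.cast_nonneg)
  obtain ⟨θ, hθ⟩ := exists_boxVertex_le_dataLaw hm α₀ F hF hv (hμ.orthonormal.comp σ hσ) hκ0
    (fun j => (hκ j).trans_eq (hc j).symm)
    (fun j => by simpa [hc, integral_inner_eigenvector_sq hF hmean hμ] using hdist j) hb
  obtain ⟨β, hβ, hβnorm⟩ := hψ.exists_apply_eq_sum_smul hρ hσ fun j => if θ j then c j else 0
  refine ⟨β, ?_, ?_⟩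
  · have hterm : ∀ j, (if θ j then c j else 0) ^ 2 / ρ (σ j) ≤ B / m := fun j => by
      split_ifs
      · rw [hc, div_right_comm, mul_div_cancel_right₀ _ (hρ _).ne']
      · simpa using div_nonneg hB m.cast_nonneg
    calc ‖β‖ ^ 2 ≤ ∑ _j : Fin m, B / m := hβnorm.trans_le (Finset.sum_le_sum fun j _ => hterm j)
      _ = B := by
        have : (m : ℝ) ≠ 0 := Nat.cast_ne_zero.2 hm.ne'
        simp [mul_div_cancel₀ _ this]
  · rw [embedding_apply] at hβ
    rw [hβ]
    exact hθ

theorem exists_norm_sq_le_and_le_dataLaw_rpow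
    (hψ : IsEigenSystem (embedding hH ∘L (embedding hH).adjoint) ρ ψ) (hρ : ∀ k, 0 < ρ k)
    [IsProbabilityMeasure F] (hF : MemLp id 2 F) (hmean : ∫ x, x ∂F = 0)
    (hμψ : IsEigenSystem (covOp F) μ ψ) (hμ : ∀ k, 0 < μ k) {r s a c C B K : ℝ} {v : NNReal}
    (hr : 0 ≤ r) (hs : 0 ≤ s) (ha : 0 ≤ a) (hc : 0 < c) (hC : 0 ≤ C) (hB : 0 < B) (hv : v ≠ 0)
    (hK : 1 ≤ K) (hKv : B * (a * C) ≤ 4 * v * K)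
    (hμa : ∀ k : ℕ, μ k ≤ a * ((k : ℝ) + 1) ^ (-(2 * s)))
    (hρc : ∀ k : ℕ, c * ((k : ℝ) + 1) ^ (-(2 * r)) ≤ ρ k)
    (hρC : ∀ k : ℕ, ρ k ≤ C * ((k : ℝ) + 1) ^ (-(2 * r))) (α₀ : ℝ) {n : ℕ} (hn : n ≠ 0)
    {b : (Fin n → L2 τ × ℝ) → L2 τ} (hb : Measurable b) :
    ∃ β : H, ‖β‖ ^ 2 ≤ B ∧ 1 / 32 ≤ (dataLaw n α₀ (toL2 hH β) F (gaussianReal 0 v)).real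
      {z | B * c / 128 * (4 * K) ^ (-(2 * r)) * (n : ℝ) ^ (-(2 * r) / (2 * (r + s) + 1))
        < ‖b z - toL2 hH β‖ ^ 2} := by
  obtain ⟨m, hm, hKn, hmK⟩ := exists_nat_le_pow_and_le hK (p := 2 * r + 2 * s) (by positivity) hn
  have hm0 : (0 : ℝ) < m := Nat.cast_pos.2 hm
  have hn0 : (0 : ℝ) < n := Nat.cast_pos.2 (Nat.pos_of_ne_zero hn)
  have hpow : (n : ℝ) ^ (-(2 * r) / (2 * (r + s) + 1))
      = ((n : ℝ) ^ (1 / (2 * r + 2 * s + 1))) ^ (-(2 * r)) := by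
    rw [← Real.rpow_mul hn0.le, one_div_mul_eq_div, mul_add]
  have hκ : ∀ j : Fin m, B * (c * (2 * m) ^ (-(2 * r))) / m ≤ B * ρ (m + j) / m := fun j => by
    have hj : ((m + j : ℕ) : ℝ) + 1 ≤ 2 * m := by exact_mod_cast (by lia : m + j.1 + 1 ≤ 2 * m)
    have hanti : (2 * m : ℝ) ^ (-(2 * r)) ≤ (((m + j : ℕ) : ℝ) + 1) ^ (-(2 * r)) :=
      Real.rpow_le_rpow_of_nonpos (by positivity) hj (by linarith)
    gcongr
    exact (mul_le_mul_of_nonneg_left hanti hc.le).trans (hρc _)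
  have hdist : ∀ j : Fin m, n * (B * ρ (m + j) / m * μ (m + j)) ≤ 4 * (v : ℝ) := fun j => by
    refine mul_div_mul_le_of_mul_le_rpow hm0 hn0.le hB.le ha hC (by positivity)
      (by positivity) ?_ (hμ _).le (hρ _).le (hμa _) (hρC _) hKv hKn
    push_cast
    linarith [(j : ℕ).cast_nonneg (α := ℝ)]
  obtain ⟨β, hβ, hprob⟩ := exists_norm_sq_le_and_le_dataLaw hψ hρ hF hmean hμψ α₀ hv hB.le
    (by positivity) hm (fun i j hij => Fin.ext (Nat.add_left_cancel hij)) hκ hdist hb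
  refine ⟨β, hβ, hprob.trans (measureReal_mono ?_)⟩
  refine Set.ofPred_subset_ofPred.2 fun z => lt_of_le_of_lt ?_
  rw [hpow]
  refine const_mul_rpow_le_of_le_two_mul hm0 (by positivity) (by linarith) (by positivity)
    (by positivity) hmK (le_of_eq ?_)
  field_simp

variable [TopologicalSpace T] {r s M A M₂ B c C : ℝ}

theorem exists_le_worstProb (h : (commonClass hH H₀ ρ ψ s M A).Nonempty)
    (hψ : IsEigenSystem (embedding hH ∘L (embedding hH).adjoint) ρ ψ) (hρ : ∀ k, 0 < ρ k)
    (hr : 0 ≤ r) (hs : 0 ≤ s) (hc : 0 < c) (hC : 0 < C)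
    (hρc : ∀ k : ℕ, c * ((k : ℝ) + 1) ^ (-(2 * r)) ≤ ρ k)
    (hρC : ∀ k : ℕ, ρ k ≤ C * ((k : ℝ) + 1) ^ (-(2 * r))) (α₀ : ℝ) (hM₂ : 0 < M₂) (hB : 0 < B) :
    ∃ δ : ℝ, 0 < δ ∧ ∀ n : ℕ, n ≠ 0 → ∀ b : (Fin n → L2 τ × ℝ) → L2 τ, Measurable b →
      ENNReal.ofReal (1 / 32) ≤ worstProb hH n α₀ (commonClass hH H₀ ρ ψ s M A) (noiseClass M₂)
        {β₀ : H | J H₀ β₀ ≤ B} b (δ * (n : ℝ) ^ (-(2 * r) / (2 * (r + s) + 1))) := by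
  obtain ⟨F₀, hF₀⟩ := h
  obtain ⟨F, hF, hmean⟩ := commonClass.exists_integral_eq_zero hF₀
  obtain ⟨μ, hμψ, hμ, hμA⟩ := commonClass.exists_eigenvalues hF
  have := hF.1.prob
  have hA := hF.1.const_pos
  set K := max 1 (B * (A * C) / (4 * M₂))
  have hK : 1 ≤ K := le_max_left _ _
  have hKM : B * (A * C) ≤ 4 * M₂ * K := (div_le_iff₀' (by positivity)).1 (le_max_right _ _)
  rw [← Real.coe_toNNReal _ hM₂.le] at hKM
  refine ⟨B * c / 128 * (4 * K) ^ (-(2 * r)), by positivity, fun n hn b hb => ?_⟩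
  obtain ⟨β, hβ, hprob⟩ := exists_norm_sq_le_and_le_dataLaw_rpow hψ hρ hF.1.memLp hmean hμψ hμ
    hr hs hA.le hc hC.le hB (Real.toNNReal_pos.2 hM₂).ne' hK hKM (fun k => (hμA k).2) hρc hρC α₀
    hn hb
  rw [← J_eq_norm_sq hF.1.nullSpace_eq_bot] at hβ
  exact (ENNReal.ofReal_le_of_le_toReal hprob).trans
    (dataLaw_le_worstProb (𝓑 := {β₀ | J H₀ β₀ ≤ B}) α₀ hF
    (gaussianReal_mem_noiseClass hM₂.le) hβ b _)

end LowerBound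

section UpperBound

theorem tendsto_limsup_zero_of_le_add_div {P : ℝ → ℕ → ℝ≥0∞} {ε : ℕ → ℝ} {K D₀ : ℝ}
    (hε : Tendsto ε atTop (𝓝 0)) (hP : ∀ D, D₀ ≤ D → 0 < D → ∀ n, n ≠ 0 →
      P D n ≤ ENNReal.ofReal (ε n) + ENNReal.ofReal (K / D)) :
    Tendsto (fun D => limsup (P D) atTop) atTop (𝓝 0) := by
  have hlimsup : ∀ᶠ D in atTop, limsup (P D) atTop ≤ ENNReal.ofReal (K / D) := by
    filter_upwards [eventually_ge_atTop D₀, eventually_gt_atTop 0] with D hD hD0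
    have hlim : Tendsto (fun n => ENNReal.ofReal (ε n) + ENNReal.ofReal (K / D)) atTop
        (𝓝 (ENNReal.ofReal (K / D))) := by
      simpa using (ENNReal.tendsto_ofReal hε).add_const (ENNReal.ofReal (K / D))
    exact (limsup_le_limsup ((eventually_ne_atTop 0).mono (hP D hD hD0))).trans_eq
      hlim.limsup_eq
  have hzero : Tendsto (fun D : ℝ => ENNReal.ofReal (K / D)) atTop (𝓝 0) := by
    simpa using ENNReal.tendsto_ofReal (tendsto_id.const_div_atTop K)
  exact tendsto_of_tendsto_of_tendsto_of_le_of_le' tendsto_const_nhds hzero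
    (.of_forall fun _ => zero_le) hlimsup

theorem one_add_mul_inv_le {L c h N : ℝ} (hL : 0 ≤ L) (hc : 0 < c) (hN : 1 ≤ N)
    (hh : c * N⁻¹ ≤ h) : 1 + L * h⁻¹ ≤ (1 + L / c) * N := by
  have hinv : h⁻¹ ≤ N / c := by
    simpa [div_eq_mul_inv, mul_comm] using inv_anti₀ (by positivity) hh
  calc 1 + L * h⁻¹ ≤ N + L * (N / c) := by gcongr
    _ = (1 + L / c) * N := by ring

theorem mul_div_mul_rpow_le {M₂ E c h N t p x : ℝ} (hM₂ : 0 ≤ M₂) (hc : 0 < c)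
    (hN : 0 < N) (hp : 0 ≤ p) (ht : 0 < t) (hh : c * N⁻¹ ≤ h) (hx : x ≤ E * N) (hE : 0 ≤ E) :
    M₂ * x / N ^ (p + 1) / (t * h ^ p) ≤ M₂ * E / c ^ p / t := calc
  M₂ * x / N ^ (p + 1) / (t * h ^ p)
      ≤ M₂ * (E * N) / N ^ (p + 1) / (t * (c * N⁻¹) ^ p) := by gcongr
  _ = M₂ * E / c ^ p / t := by
    rw [Real.mul_rpow hc.le (by positivity), Real.inv_rpow hN.le, Real.rpow_add_one hN.ne']
    field_simp

theorem exists_const_mul_inv_le_rpow {lam : ℕ → ℝ} {p : ℝ} (hp : 0 < p) (hlam : ∀ n, 0 < lam n)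
    (h : lam =Θ[atTop] fun n : ℕ => (n : ℝ) ^ (-p / (p + 1))) :
    ∃ c c' : ℝ, 0 < c ∧ 0 < c' ∧ ∀ n : ℕ, n ≠ 0 →
      c * ((n : ℝ) ^ (1 / (p + 1)))⁻¹ ≤ lam n ^ (1 / p) ∧
        lam n ^ (1 / p) ≤ c' * ((n : ℝ) ^ (1 / (p + 1)))⁻¹ := by
  have hpow : ∀ n : ℕ, ((n : ℝ) ^ (-p / (p + 1))) ^ (1 / p) = ((n : ℝ) ^ (1 / (p + 1)))⁻¹ :=
    fun n => by
      rw [← Real.rpow_mul n.cast_nonneg, ← Real.rpow_neg n.cast_nonneg]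
      congr 1
      field_simp
  have hroot := h.rpow (r := 1 / p) (.of_forall fun n => (hlam n).le)
    (.of_forall fun n => Real.rpow_nonneg n.cast_nonneg _)
  simp only [hpow] at hroot
  obtain ⟨c, c', hc, hc', hbound⟩ := exists_const_mul_le_of_isTheta hroot
    (fun n => Real.rpow_pos_of_pos (hlam n) _) fun n => by positivity
  exact ⟨c, c', hc, hc', fun n hn => hbound n (by positivity)⟩

theorem tendsto_rpow_sq_div_atTop {p : ℝ} (hp : 1 < p) :
    Tendsto (fun n : ℕ => ((n : ℝ) ^ (1 / (p + 1))) ^ 2 / n) atTop (𝓝 0) := by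
  have hexp : 0 < 1 - 2 / (p + 1) := sub_pos.2 ((div_lt_one (by linarith)).2 (by linarith))
  refine ((tendsto_rpow_neg_atTop hexp).comp tendsto_natCast_atTop_atTop).congr' ?_
  filter_upwards [eventually_gt_atTop 0] with n hn
  have hn0 : (0 : ℝ) < n := Nat.cast_pos.2 hn
  rw [Function.comp_apply, neg_sub, Real.rpow_sub_one hn0.ne', ← Real.rpow_mul_natCast hn0.le]
  push_cast
  rw [one_div_mul_eq_div]

variable {T : Type*} [TopologicalSpace T] [MeasurableSpace T] {τ : Measure T}
  [SecondCountableTopology (L2 τ)] {H : Type*} [NormedAddCommGroup H] [InnerProductSpace ℝ H]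
  [CompleteSpace H] [RKHS ℝ H T ℝ] {hH : ∀ f : H, MemLp (f : T → ℝ) 2 τ} {H₀ : Submodule ℝ H}
  [H₀.HasOrthogonalProjection] {ρ : ℕ → ℝ} {ψ : ℕ → L2 τ} {r s M A M₂ B C : ℝ}

theorem commonClass.dataLaw_lt_norm_sub_sq_le {F : Measure (L2 τ)}
    (hF : F ∈ commonClass hH H₀ ρ ψ s M A)
    (hψ : IsEigenSystem (embedding hH ∘L (embedding hH).adjoint) ρ ψ) (hρ : ∀ k, 0 < ρ k)
    (hr : 0 ≤ r) (hs : 0 ≤ s) (hp : 1 < 2 * r + 2 * s) (hC : 0 < C)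
    (hρC : ∀ k : ℕ, ρ k ≤ C * ((k : ℝ) + 1) ^ (-(2 * r))) {G : Measure ℝ}
    (hG : G ∈ noiseClass M₂) {n : ℕ} (hn : n ≠ 0) {h t : ℝ} (hh : 0 < h) (ht : 0 < t) {L : ℝ}
    (hL : max 1 (A * C) * 2 ^ (2 * r + 2 * s) / (2 * r + 2 * s - 1) ≤ L) (α₀ : ℝ) {β₀ : H}
    (hβ₀ : J H₀ β₀ ≤ B) {b : (Fin n → L2 τ × ℝ) → H} (hbm : Measurable fun z => toL2 hH (b z))
    (hb : ∀ z, IsRegularizedSlope hH H₀ n (h ^ (2 * r + 2 * s)) z (b z)) :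
    dataLaw n α₀ (toL2 hH β₀) F G {z | (min A⁻¹ C⁻¹)⁻¹ * (64 * t + 16 * B) * h ^ (2 * r)
        < ‖toL2 hH (b z) - toL2 hH β₀‖ ^ 2}
      ≤ ENNReal.ofReal (16 * (max M 1 * (1 + L * h⁻¹) ^ 2 / n))
        + ENNReal.ofReal (M₂ * (1 + L * h⁻¹) / n / (t * h ^ (2 * r + 2 * s))) := by
  obtain ⟨μ, hμψ, hμ, hμA⟩ := commonClass.exists_eigenvalues hF
  have := hF.1.prob
  have hA := hF.1.const_pos
  have hM₂ : 0 ≤ M₂ := (integral_nonneg fun e => sq_nonneg e).trans hG.2.2.2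
  have hκ := min_mul_rpow_le_add_div (inv_pos.2 hA) hC hμ hρ (fun k => (hμA k).1) hρC
    (by positivity) (by positivity) hh
  obtain ⟨hS, hSle⟩ := summable_div_add_div_and_tsum_le hμ hρ (le_max_left 1 (A * C))
    (fun k => (mul_le_mul_rpow_neg_add (by positivity) (hμ k).le (hρ k).le (hμA k).2
      (hρC k)).trans (mul_le_mul_of_nonneg_right (le_max_right _ _) (by positivity))) hp hh
  have hSL := hSle.trans (mul_le_mul_of_nonneg_right hL (inv_pos.2 hh).le)
  have hS0 : 0 ≤ ∑' k, μ k / (μ k + h ^ (2 * r + 2 * s) / ρ k) :=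
    tsum_nonneg fun k => div_nonneg (hμ k).le
      (add_pos (hμ k) (div_pos (Real.rpow_pos_of_pos hh _) (hρ k))).le
  have hu : (min A⁻¹ C⁻¹ * h ^ (2 * s))⁻¹ * (64 * (t * h ^ (2 * r + 2 * s))
      + 16 * (h ^ (2 * r + 2 * s) * J H₀ β₀))
      ≤ (min A⁻¹ C⁻¹)⁻¹ * (64 * t + 16 * B) * h ^ (2 * r) := calc
    _ = (min A⁻¹ C⁻¹)⁻¹ * (64 * t + 16 * J H₀ β₀) * h ^ (2 * r) := by
      rw [Real.rpow_add hh]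
      field_simp
    _ ≤ _ := by gcongr
  refine (FLR.dataLaw_lt_norm_sub_sq_le hF.1.nullSpace_eq_bot hψ hρ hμ hμψ.antitone
    (zero_le_one.trans (le_max_right M 1))
    (isOrthogonalDesign_feature hF.1.memLp hμψ fun k => hF.1.fourth_moment (ψ k)) hG hn
    (Real.rpow_pos_of_pos hh _) (by positivity) hκ (by positivity) hS.hasSum α₀ hbm hb hu).trans ?_
  gcongr

theorem worstProb_le_add (hψ : IsEigenSystem (embedding hH ∘L (embedding hH).adjoint) ρ ψ)
    (hρ : ∀ k, 0 < ρ k) (hr : 0 ≤ r) (hs : 0 ≤ s) (hp : 1 < 2 * r + 2 * s) (hC : 0 < C)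
    (hρC : ∀ k : ℕ, ρ k ≤ C * ((k : ℝ) + 1) ^ (-(2 * r))) (α₀ : ℝ) {n : ℕ} (hn : n ≠ 0)
    {h t c c' N L D : ℝ} (hh : 0 < h) (ht : 0 < t) (hB : 0 ≤ B) (hc : 0 < c) (hN : 1 ≤ N)
    (hNn : N ^ (2 * r + 2 * s + 1) = n) (hch : c * N⁻¹ ≤ h) (hhc : h ≤ c' * N⁻¹)
    (hL : max 1 (A * C) * 2 ^ (2 * r + 2 * s) / (2 * r + 2 * s - 1) ≤ L)
    (hD : (min A⁻¹ C⁻¹)⁻¹ * (64 * t + 16 * B) * c' ^ (2 * r) ≤ D)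
    {b : (Fin n → L2 τ × ℝ) → H} (hbm : Measurable fun z => toL2 hH (b z))
    (hb : ∀ z, IsRegularizedSlope hH H₀ n (h ^ (2 * r + 2 * s)) z (b z)) :
    worstProb hH n α₀ (commonClass hH H₀ ρ ψ s M A) (noiseClass M₂) {β₀ : H | J H₀ β₀ ≤ B}
        (fun z => toL2 hH (b z)) (D * N ^ (-(2 * r)))
      ≤ ENNReal.ofReal (16 * max M 1 * (1 + L / c) ^ 2 * (N ^ 2 / n))
        + ENNReal.ofReal (M₂ * (1 + L / c) / c ^ (2 * r + 2 * s) / t) := by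
  refine iSup₂_le fun F hF => iSup₂_le fun G hG => iSup₂_le fun β₀ hβ₀ => ?_
  have hN0 : 0 < N := zero_lt_one.trans_le hN
  have hA := hF.1.const_pos
  have hM₂ : 0 ≤ M₂ := (integral_nonneg fun e => sq_nonneg e).trans hG.2.2.2
  have hL0 : 0 ≤ L := hL.trans' (div_nonneg (by positivity) (by linarith))
  have hc' : 0 ≤ c' := nonneg_of_mul_nonneg_left (hh.le.trans hhc) (by positivity)
  have hE := one_add_mul_inv_le hL0 hc hN hch
  have hthreshold : (min A⁻¹ C⁻¹)⁻¹ * (64 * t + 16 * B) * h ^ (2 * r) ≤ D * N ^ (-(2 * r)) := calc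
    _ ≤ (min A⁻¹ C⁻¹)⁻¹ * (64 * t + 16 * B) * (c' * N⁻¹) ^ (2 * r) := by gcongr
    _ = (min A⁻¹ C⁻¹)⁻¹ * (64 * t + 16 * B) * c' ^ (2 * r) * N ^ (-(2 * r)) := by
      rw [Real.mul_rpow hc' (by positivity), Real.inv_rpow hN0.le, Real.rpow_neg hN0.le,
        mul_assoc _ (c' ^ _)]
    _ ≤ D * N ^ (-(2 * r)) := by gcongr
  refine (measure_mono (Set.ofPred_subset_ofPred.2 fun z => hthreshold.trans_lt)).trans
    ((commonClass.dataLaw_lt_norm_sub_sq_le hF hψ hρ hr hs hp hC hρC hG hn hh ht hL α₀ hβ₀ hbm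
      hb).trans (add_le_add (ENNReal.ofReal_le_ofReal ?_) (ENNReal.ofReal_le_ofReal ?_)))
  · calc 16 * (max M 1 * (1 + L * h⁻¹) ^ 2 / n) ≤ 16 * (max M 1 * ((1 + L / c) * N) ^ 2 / n) := by
          gcongr
      _ = 16 * max M 1 * (1 + L / c) ^ 2 * (N ^ 2 / n) := by ring
  · rw [← hNn]
    exact mul_div_mul_rpow_le hM₂ hc hN0 (by positivity) ht hch hE (by positivity)

theorem tendsto_limsup_worstProb
    (hψ : IsEigenSystem (embedding hH ∘L (embedding hH).adjoint) ρ ψ) (hρ : ∀ k, 0 < ρ k)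
    (hr : 0 ≤ r) (hs : 0 ≤ s) (hrs : 1 < 2 * (r + s)) (hC : 0 < C)
    (hρC : ∀ k : ℕ, ρ k ≤ C * ((k : ℝ) + 1) ^ (-(2 * r))) (α₀ : ℝ) (hA : 0 < A) (hB : 0 ≤ B)
    {lam : ℕ → ℝ} (hlam : ∀ n, 0 < lam n)
    (hrate : lam =Θ[atTop] fun n : ℕ => (n : ℝ) ^ (-(2 * (r + s)) / (2 * (r + s) + 1)))
    {b : (n : ℕ) → (Fin n → L2 τ × ℝ) → H} (hbm : ∀ n, Measurable fun z => toL2 hH (b n z))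
    (hb : ∀ n z, IsRegularizedSlope hH H₀ n (lam n) z (b n z)) :
    Tendsto (fun D : ℝ => limsup (fun n : ℕ =>
      worstProb hH n α₀ (commonClass hH H₀ ρ ψ s M A) (noiseClass M₂) {β₀ : H | J H₀ β₀ ≤ B}
        (fun z => toL2 hH (b n z)) (D * (n : ℝ) ^ (-(2 * r) / (2 * (r + s) + 1)))) atTop)
      atTop (𝓝 0) := by
  rw [mul_add] at hrs
  simp only [mul_add 2 r s] at hrate ⊢
  set p := 2 * r + 2 * s
  have hp0 : 0 < p := zero_lt_one.trans hrs
  obtain ⟨c, c', hc, hc', hbandwidth⟩ := exists_const_mul_inv_le_rpow hp0 hlam hrate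
  set L := max 1 (A * C) * 2 ^ p / (p - 1)
  set q := (min A⁻¹ C⁻¹)⁻¹ * c' ^ (2 * r)
  have hq : 0 < q := by positivity
  have hε := (tendsto_rpow_sq_div_atTop hrs).const_mul (16 * max M 1 * (1 + L / c) ^ 2)
  rw [mul_zero] at hε
  refine tendsto_limsup_zero_of_le_add_div (K := M₂ * (1 + L / c) / c ^ p * (128 * q))
    (D₀ := 32 * B * q) hε fun D hD hD0 n hn => ?_
  have hn1 : (1 : ℝ) ≤ n := by exact_mod_cast Nat.one_le_iff_ne_zero.2 hn
  have hlam_eq : (lam n ^ (1 / p)) ^ p = lam n := by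
    rw [← Real.rpow_mul (hlam n).le, one_div_mul_cancel hp0.ne', Real.rpow_one]
  have hNn : ((n : ℝ) ^ (1 / (p + 1))) ^ (p + 1) = n := by
    rw [← Real.rpow_mul n.cast_nonneg, one_div_mul_cancel (by positivity), Real.rpow_one]
  have hD' : (min A⁻¹ C⁻¹)⁻¹ * (64 * (D / (128 * q)) + 16 * B) * c' ^ (2 * r) ≤ D := calc
    _ = q * (64 * (D / (128 * q))) + 16 * B * q := by ring
    _ = D / 2 + 32 * B * q / 2 := by field_simp; ring
    _ ≤ D := by linarith
  have hbound := worstProb_le_add (M := M) (M₂ := M₂) hψ hρ hr hs hrs hC hρC α₀ hn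
    (Real.rpow_pos_of_pos (hlam n) _) (div_pos hD0 (by positivity)) hB hc
    (Real.one_le_rpow hn1 (by positivity)) hNn (hbandwidth n hn).1 (hbandwidth n hn).2 le_rfl hD'
    (hbm n) (hlam_eq.symm ▸ hb n)
  rwa [← Real.rpow_mul n.cast_nonneg, one_div_mul_eq_div, div_div_eq_mul_div] at hbound

end UpperBound

theorem isEigenSystem_embedding_comp_adjoint {T : Type*} [MeasurableSpace T] {τ : Measure T}
    {H : Type*} [NormedAddCommGroup H] [InnerProductSpace ℝ H] [CompleteSpace H] [RKHS ℝ H T ℝ]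
    (hH : ∀ f : H, MemLp (f : T → ℝ) 2 τ) {H₀ : Submodule ℝ H} [H₀.HasOrthogonalProjection]
    (h0 : H₀ = ⊥) {Kop : L2 τ →L[ℝ] L2 τ} (hKop : IsIntegralOperator τ (penKernel H₀) Kop)
    {ρ : ℕ → ℝ} {ψ : ℕ → L2 τ} (hψ : IsEigenSystem Kop ρ ψ) :
    IsEigenSystem (embedding hH ∘L (embedding hH).adjoint) ρ ψ := by
  have hker : penKernel H₀ = fun s t => RKHS.kerFun H t (1 : ℝ) s := by
    funext s t
    rw [penKernel, pen_eq_self h0]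
  rwa [← eq_embedding_comp_adjoint hH (hker ▸ hKop)]

end FLR

theorem corollary10_general {T : Type*} [TopologicalSpace T] [MeasurableSpace T] (τ : Measure T)
    [SecondCountableTopology (FLR.L2 τ)]
    {H : Type*} [NormedAddCommGroup H] [InnerProductSpace ℝ H] [CompleteSpace H] [RKHS ℝ H T ℝ]
    (hH : ∀ f : H, MemLp (f : T → ℝ) 2 τ)
    (H₀ : Submodule ℝ H) [H₀.HasOrthogonalProjection]
    (ρ : ℕ → ℝ) (ψ : ℕ → FLR.L2 τ)
    (hψ : ∃ Kop : FLR.L2 τ →L[ℝ] FLR.L2 τ,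
      FLR.IsIntegralOperator τ (FLR.penKernel (T := T) H₀) Kop ∧ FLR.IsEigenSystem Kop ρ ψ)
    (r s : ℝ) (hr : 0 ≤ r) (hs : 0 ≤ s) (hrs : 1 < 2 * (r + s))
    (hρ_pos : ∀ k, 0 < ρ k)
    (hρ : ρ =Θ[atTop] fun k : ℕ => ((k : ℝ) + 1) ^ (-2 * r))
    (α₀ M A M₂ B : ℝ) (hM₂ : 0 < M₂) (hB : 0 < B)
    (hne : (FLR.commonClass hH H₀ ρ ψ s M A).Nonempty) :
    (∃ δ : ℝ, 0 < δ ∧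
      0 < liminf (fun n : ℕ =>
        ⨅ (b : (Fin n → FLR.L2 τ × ℝ) → FLR.L2 τ) (_ : Measurable b),
          FLR.worstProb hH n α₀ (FLR.commonClass hH H₀ ρ ψ s M A) (FLR.noiseClass M₂)
            {β₀ : H | FLR.J H₀ β₀ ≤ B} b
            (δ * (n : ℝ) ^ (-(2 * r) / (2 * (r + s) + 1)))) atTop) ∧
    (∀ lam : ℕ → ℝ, (∀ n, 0 < lam n) →
      (lam =Θ[atTop] fun n : ℕ => (n : ℝ) ^ (-(2 * (r + s)) / (2 * (r + s) + 1))) →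
      ∃ b : (n : ℕ) → (Fin n → FLR.L2 τ × ℝ) → H,
        (∀ n z β, FLR.IsRegularizedSlope hH H₀ n (lam n) z β ↔ β = b n z) ∧
        (∀ n, Measurable fun z => FLR.toL2 hH (b n z)) ∧
        Tendsto (fun D : ℝ => limsup (fun n : ℕ =>
          FLR.worstProb hH n α₀ (FLR.commonClass hH H₀ ρ ψ s M A) (FLR.noiseClass M₂)
            {β₀ : H | FLR.J H₀ β₀ ≤ B} (fun z => FLR.toL2 hH (b n z))
            (D * (n : ℝ) ^ (-(2 * r) / (2 * (r + s) + 1)))) atTop) atTop (𝓝 0)) := by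
  obtain ⟨F₀, hF₀⟩ := hne
  obtain ⟨Kop, hKop, hψKop⟩ := hψ
  have h0 : H₀ = ⊥ := hF₀.1.nullSpace_eq_bot
  have hψι := FLR.isEigenSystem_embedding_comp_adjoint hH h0 hKop hψKop
  obtain ⟨c, C, hc, hC, hρcC⟩ := FLR.exists_const_mul_le_of_isTheta hρ hρ_pos fun k => by positivity
  have hρcC' : ∀ k : ℕ, c * ((k : ℝ) + 1) ^ (-(2 * r)) ≤ ρ k ∧
      ρ k ≤ C * ((k : ℝ) + 1) ^ (-(2 * r)) := fun k => by
    rw [← neg_mul]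
    exact hρcC k (by positivity)
  refine ⟨?_, fun lam hlam hrate => ?_⟩
  · obtain ⟨δ, hδ, hlower⟩ := FLR.exists_le_worstProb ⟨F₀, hF₀⟩ hψι hρ_pos hr hs hc hC
      (fun k => (hρcC' k).1) (fun k => (hρcC' k).2) α₀ hM₂ hB
    refine ⟨δ, hδ, lt_of_lt_of_le (ENNReal.ofReal_pos.2 (by norm_num : (0 : ℝ) < 1 / 32))
      (le_liminf_of_le isCobounded_ge_of_top ?_)⟩
    exact (eventually_ne_atTop 0).mono fun n hn => le_iInf₂ (hlower n hn)
  · have hslope : ∀ n z β, FLR.IsRegularizedSlope hH H₀ n (lam n) z β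
        ↔ β = FLR.slopeEstimate (FLR.embedding hH) (lam n) z := fun n z β =>
      FLR.isRegularizedSlope_iff h0 (hlam n) z β
    have hmeas : ∀ n, Measurable fun z : Fin n → FLR.L2 τ × ℝ =>
        FLR.toL2 hH (FLR.slopeEstimate (FLR.embedding hH) (lam n) z) := fun n =>
      ((FLR.embedding hH).continuous.comp (FLR.continuous_slopeEstimate _ (hlam n))).measurable
    exact ⟨_, hslope, hmeas, FLR.tendsto_limsup_worstProb hψι hρ_pos hr hs hrs hC
      (fun k => (hρcC' k).2) α₀ hF₀.1.const_pos hB.le hlam hrate hmeas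
      fun n z => (hslope n z _).2 rfl⟩

theorem corollary10 {d : ℕ} (T : Set (EuclideanSpace ℝ (Fin d))) (hT : IsCompact T)
    (τ : Measure T) [IsFiniteMeasure τ]
    -- the reproducing kernel Hilbert space `H` of square integrable functions on `T`,
    -- and the finite-dimensional null space `H₀` of the penalty
    {H : Type*} [NormedAddCommGroup H] [InnerProductSpace ℝ H] [CompleteSpace H] [RKHS ℝ H T ℝ]
    (hH : ∀ f : H, MemLp (f : T → ℝ) 2 τ)
    (H₀ : Submodule ℝ H) [FiniteDimensional ℝ H₀]
    -- the kernel `K` of the complement of `H₀`, its eigenvalues `ρ` and eigenfunctions `ψ`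
    (hK : Continuous (Function.uncurry (FLR.penKernel (T := T) H₀)))
    (ρ : ℕ → ℝ) (ψ : ℕ → FLR.L2 τ)
    (hψ : ∃ Kop : FLR.L2 τ →L[ℝ] FLR.L2 τ,
      FLR.IsIntegralOperator τ (FLR.penKernel (T := T) H₀) Kop ∧ FLR.IsEigenSystem Kop ρ ψ)
    (r s : ℝ) (hr : 1 / 2 < r) (hs : 1 / 2 < s)
    (hρ_pos : ∀ k, 0 < ρ k)
    (hρ : ρ =Θ[atTop] fun k : ℕ => ((k : ℝ) + 1) ^ (-2 * r))
    (α₀ M A M₂ B : ℝ) (hM₂ : 0 < M₂) (hB : 0 < B)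
    (hne : (FLR.commonClass hH H₀ ρ ψ s M A).Nonempty) :
    -- lower bound over all estimators
    (∃ δ : ℝ, 0 < δ ∧
      0 < liminf (fun n : ℕ =>
        ⨅ (b : (Fin n → FLR.L2 τ × ℝ) → FLR.L2 τ) (_ : Measurable b),
          FLR.worstProb hH n α₀ (FLR.commonClass hH H₀ ρ ψ s M A) (FLR.noiseClass M₂)
            {β₀ : H | FLR.J H₀ β₀ ≤ B} b
            (δ * (n : ℝ) ^ (-(2 * r) / (2 * (r + s) + 1)))) atTop) ∧
    -- the regularized estimator is well defined, is an estimator, and attains the rate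
    (∀ lam : ℕ → ℝ, (∀ n, 0 < lam n) →
      (lam =Θ[atTop] fun n : ℕ => (n : ℝ) ^ (-(2 * (r + s)) / (2 * (r + s) + 1))) →
      ∃ b : (n : ℕ) → (Fin n → FLR.L2 τ × ℝ) → H,
        (∀ n z β, FLR.IsRegularizedSlope hH H₀ n (lam n) z β ↔ β = b n z) ∧
        (∀ n, Measurable fun z => FLR.toL2 hH (b n z)) ∧
        Tendsto (fun D : ℝ => limsup (fun n : ℕ =>
          FLR.worstProb hH n α₀ (FLR.commonClass hH H₀ ρ ψ s M A) (FLR.noiseClass M₂)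
            {β₀ : H | FLR.J H₀ β₀ ≤ B} (fun z => FLR.toL2 hH (b n z))
            (D * (n : ℝ) ^ (-(2 * r) / (2 * (r + s) + 1)))) atTop) atTop (𝓝 0)) := by
  have : Fact ((2 : ℝ≥0∞) ≠ ⊤) := ⟨ENNReal.ofNat_ne_top⟩
  have : SecondCountableTopology (FLR.L2 τ) := Lp.SecondCountableTopology
  exact corollary10_general τ hH H₀ ρ ψ hψ r s (by linarith) (by linarith) (by linarith) hρ_pos hρ
    α₀ M A M₂ B hM₂ hB hne
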